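/- Let $L$ be a Lie conformal algebra over $\mathbb{C}$, i.e. a $\mathbb{C}[\partial]$-module with a conformally sesquilinear $\lambda$-bracket $[\cdot_\lambda\cdot]:L\times L\to L[\lambda]$ satisfying $[p_\lambda q]=-[q_{-\lambda-\partial}\,p]$ and the Jacobi identity, and let $N:L\to L$ be a Nijenhuis operator, i.e. a $\mathbb{C}[\partial]$-linear map with $$[N(p)_\lambda N(q)]=N\big([N(p)_\lambda q]+[p_\lambda N(q)]-N([p_\lambda q])\big)\qquad(p,q\in L).$$ Let $(L,[\cdot_\lambda\cdot]_N)$ be the induced Lie conformal algebra, with $[p_\lambda q]_N=[N(p)_\lambda q]+[p_\lambda N(q)]-N([p_\lambda q])$. For $n\ge 0$ let $C^n(L,L)$ be the space of $n$-cochains: $\mathbb{C}$-multilinear maps $f_{\lambda_1,\dots,\lambda_{n-1}}:L^{n}\to L[\lambda_1,\dots,\lambda_{n-1}]$ that are conformally sesquilinear, $f(\dots,\partial p_k,\dots)=-\lambda_k f(\dots,p_k,\dots)$ for $1\le k\le n$, and conformally skew-symmetric under simultaneous permutations of the $p_k$ and the $\lambda_k$, where $\lambda_n=-\partial-\lambda_1-\dots-\lambda_{n-1}$;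 $C^0(L,L)=L/\partial L$. Let $\delta$ be the coboundary operator of $(L,[\cdot_\lambda\cdot])$ with adjoint coefficients, $$(\delta f)_{\lambda_1,\dots,\lambda_n}(p_1,\dots,p_{n+1})=\sum_{i=1}^{n+1}(-1)^{i+1}[{p_i}_{\lambda_i}f_{\dots\hat{\lambda_i}\dots}(\dots,\hat{p_i},\dots)]+\sum_{i<j}(-1)^{i+j}f_{\lambda_i+\lambda_j,\dots\hat{\lambda_i}\dots\hat{\lambda_j}\dots}([{p_i}_{\lambda_i}p_j],\dots,\hat{p_i},\dots,\hat{p_j},\dots)$$ (with $\lambda_{n+1}=-\partial-\lambda_1-\dots-\lambda_n$), let $\delta_N$ be the coboundary operator of $(L,[\cdot_\lambda\cdot]_N)$ with coefficients in its adjoint representation, given by the same formula with $[\cdot_\lambda\cdot]_N$, and let $d_N:C^n(L,L)\to C^{n+1}(L,L)$ be the differential of the Nijenhuis operator, $$d_Nf=\sum_{i=1}^{n+1}(-1)^{i+1}[N(p_i)_{\lambda_i}f_{\dots\hat{\lambda_i}\dots}(\dots,\hat{p_i},\dots)]+\sum_{i<j}(-1)^{i+j}f_{\lambda_i+\lambda_j,\dots}([{p_i}_{\lambda_i}p_j]_N,\dots,\hat{p_i},\dots,\hat{p_j},\dots)-N(\delta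 f),$$ whose cohomology is denoted $H^*_N(L)$. For $n\ge0$ put $\Phi^n:C^n(L,L)\to C^{n+1}(L,L)$, $\Phi^n(f)=(-1)^{n+1}\delta f$. Then $\delta_N\circ\Phi^n=\Phi^{n+1}\circ d_N$ for all $n\ge 0$. Consequently, for every $n\ge0$ there is a linear map $$H^n_N(L)\to H^{n+1}\big((L,[\cdot_\lambda\cdot]_N),(L,[\cdot_\lambda\cdot]_N)\big),\qquad [f]\mapsto[\Phi^n(f)],$$ from the cohomology of the Nijenhuis operator to the cohomology of the induced Lie conformal algebra with coefficients in its adjoint representation. -/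

import Mathlib

open scoped TensorProduct Polynomial

namespace LieConformal

section Coefficients
variable {L : Type*} [AddCommGroup L] [Module ℂ L]
variable {R S T : Type*} [CommRing R] [Algebra ℂ R] [CommRing S] [Algebra ℂ S]
  [CommRing T] [Algebra ℂ T]

/-- Change of coefficients `R[L] → S[L]` along `φ : R → S`. Throughout, `L` with polynomial
coefficients in a ring `R` of polynomials in the formal variables `λ` is `R ⊗[ℂ] L`; in particular
`L[λ]` is `ℂ[X] ⊗[ℂ] L`, where the variable `X` is `λ`. For `a : R`, `mapCoeff (Polynomial.aeval a)`
is the substitution `λ ↦ a`. -/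
noncomputable def mapCoeff (φ : R →ₐ[ℂ] S) : R ⊗[ℂ] L →ₗ[ℂ] S ⊗[ℂ] L :=
  LinearMap.rTensor L φ.toLinearMap

@[simp] theorem mapCoeff_tmul (φ : R →ₐ[ℂ] S) (r : R) (p : L) :
    mapCoeff φ (r ⊗ₜ p) = φ r ⊗ₜ[ℂ] p := rfl

theorem mapCoeff_smul (φ : R →ₐ[ℂ] S) (r : R) (u : R ⊗[ℂ] L) :
    mapCoeff φ (r • u) = φ r • mapCoeff φ u := by
  induction u with
  | zero => simp
  | add x y hx hy => simp [smul_add, hx, hy]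
  | tmul s p => simp [TensorProduct.smul_tmul']

theorem mapCoeff_mapCoeff (φ : R →ₐ[ℂ] S) (ψ : S →ₐ[ℂ] T) (u : R ⊗[ℂ] L) :
    mapCoeff ψ (mapCoeff φ u) = mapCoeff (ψ.comp φ) u := by
  induction u with
  | zero => simp
  | add x y hx hy => simp [hx, hy]
  | tmul s p => simp

theorem mapCoeff_baseChange (φ : R →ₐ[ℂ] S) (f : L →ₗ[ℂ] L) (u : R ⊗[ℂ] L) :
    mapCoeff φ (f.baseChange R u) = f.baseChange S (mapCoeff φ u) := by
  induction u with
  | zero => simp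
  | add x y hx hy => simp [hx, hy]
  | tmul s p => simp

/-- For a `λ`-bracket `β : L × L → L[λ]` and `a : R`, the operation `(u, v) ↦ [u_a v]` on `R ⊗ L`:
the `R`-bilinear extension of `(p, q) ↦ β(p, q)` with `a` substituted for `λ`. -/
noncomputable def extend (β : L →ₗ[ℂ] L →ₗ[ℂ] ℂ[X] ⊗[ℂ] L) (a : R) :
    R ⊗[ℂ] L →ₗ[R] R ⊗[ℂ] L →ₗ[R] R ⊗[ℂ] L :=
  LinearMap.liftBaseChange R
    { toFun := fun p => LinearMap.liftBaseChange R (mapCoeff (Polynomial.aeval a) ∘ₗ β p)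
      map_add' := fun p q => by ext; simp
      map_smul' := fun c p => by ext; simp }

@[simp] theorem extend_tmul (β : L →ₗ[ℂ] L →ₗ[ℂ] ℂ[X] ⊗[ℂ] L) (a r s : R) (p q : L) :
    extend β a (r ⊗ₜ p) (s ⊗ₜ q) = (r * s) • mapCoeff (Polynomial.aeval a) (β p q) := by
  simp [extend, mul_smul]

theorem mapCoeff_extend (β : L →ₗ[ℂ] L →ₗ[ℂ] ℂ[X] ⊗[ℂ] L) (φ : R →ₐ[ℂ] S) (a : R)
    (u v : R ⊗[ℂ] L) :
    mapCoeff φ (extend β a u v) = extend β (φ a) (mapCoeff φ u) (mapCoeff φ v) := by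
  induction u with
  | zero => simp
  | add x y hx hy => simp [hx, hy]
  | tmul r p =>
    induction v with
    | zero => simp
    | add x y hx hy => simp [hx, hy]
    | tmul s q =>
      have h : φ.comp (Polynomial.aeval a) = Polynomial.aeval (φ a) := by ext; simp
      simp [mapCoeff_smul, mapCoeff_mapCoeff, h]

end Coefficients

section Algebras
variable (L : Type*) [AddCommGroup L] [Module ℂ L] [Module ℂ[X] L] [IsScalarTower ℂ ℂ[X] L]

/-- The operator `∂` of a `ℂ[∂]`-module `L`. The action of `ℂ[∂]` is the given `ℂ[X]`-module
structure of `L`. -/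
noncomputable def del : L →ₗ[ℂ] L := Algebra.lsmul ℂ ℂ L (Polynomial.X : ℂ[X])

/-- A `λ`-bracket `L × L → L[λ]`, `ℂ`-bilinear and conformally sesquilinear:
`[∂p_λ q] = -λ[p_λ q]` and `[p_λ ∂q] = (∂ + λ)[p_λ q]`. -/
structure SesquilinearBracket where
  bracket : L →ₗ[ℂ] L →ₗ[ℂ] ℂ[X] ⊗[ℂ] L
  del_left : ∀ p q, bracket (del L p) q = -((Polynomial.X : ℂ[X]) • bracket p q)
  del_right : ∀ p q, bracket p (del L q) =
    (del L).baseChange ℂ[X] (bracket p q) + (Polynomial.X : ℂ[X]) • bracket p q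

/-- The substitution `λ ↦ -λ-∂` on `L[λ]`: it sends `∑ λ^k c_k` to `∑ (-λ-∂)^k c_k`. -/
noncomputable def dagger : ℂ[X] ⊗[ℂ] L →ₗ[ℂ] ℂ[X] ⊗[ℂ] L :=
  TensorProduct.lift (LinearMap.mk₂ ℂ
    (fun P c => Polynomial.aeval
      (-(Polynomial.X : ℂ[X]) • (LinearMap.id : ℂ[X] ⊗[ℂ] L →ₗ[ℂ] ℂ[X] ⊗[ℂ] L)
        - ((del L).baseChange ℂ[X]).restrictScalars ℂ) P ((1 : ℂ[X]) ⊗ₜ[ℂ] c))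
    (by simp) (by simp) (by simp [TensorProduct.tmul_add]) (by simp))

/-- A Lie conformal algebra structure on the `ℂ[∂]`-module `L`: a sesquilinear `λ`-bracket with
`[p_λ q] = -[q_{-λ-∂} p]` and `[p_λ [q_μ r]] = [[p_λ q]_{λ+μ} r] + [q_μ [p_λ r]]` in `L[λ, μ]`;
here `λ` and `μ` are `MvPolynomial.X 0` and `MvPolynomial.X 1`. -/
structure LieConformalAlgebra extends SesquilinearBracket L where
  skew : ∀ p q, bracket p q = -dagger L (bracket q p)
  jacobi : ∀ p q r,
    extend bracket (MvPolynomial.X 0 : MvPolynomial (Fin 2) ℂ) (1 ⊗ₜ p)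
        (extend bracket (MvPolynomial.X 1) (1 ⊗ₜ q) (1 ⊗ₜ r)) =
      extend bracket (MvPolynomial.X 0 + MvPolynomial.X 1)
        (extend bracket (MvPolynomial.X 0) (1 ⊗ₜ p) (1 ⊗ₜ q)) (1 ⊗ₜ r) +
      extend bracket (MvPolynomial.X 1 : MvPolynomial (Fin 2) ℂ) (1 ⊗ₜ q)
        (extend bracket (MvPolynomial.X 0) (1 ⊗ₜ p) (1 ⊗ₜ r))

section Nijenhuis
variable {L}
variable {R : Type*} [CommRing R] [Algebra ℂ R]

theorem SesquilinearBracket.extend_del_left (B : SesquilinearBracket L) (a : R)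
    (u v : R ⊗[ℂ] L) :
    extend B.bracket a ((del L).baseChange R u) v = -(a • extend B.bracket a u v) := by
  induction u with
  | zero => simp
  | add x y hx hy => simp [hx, hy, smul_add]; abel
  | tmul r p =>
    induction v with
    | zero => simp
    | add x y hx hy => simp only [map_add, hx, hy, smul_add]; abel
    | tmul s q => simp [B.del_left, mapCoeff_smul, smul_smul, mul_comm]

theorem SesquilinearBracket.extend_del_right (B : SesquilinearBracket L) (a : R)
    (u v : R ⊗[ℂ] L) :
    extend B.bracket a u ((del L).baseChange R v) =
      (del L).baseChange R (extend B.bracket a u v) + a • extend B.bracket a u v := by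
  induction u with
  | zero => simp
  | add x y hx hy => simp [hx, hy, smul_add]; abel
  | tmul r p =>
    induction v with
    | zero => simp
    | add x y hx hy => simp only [map_add, hx, hy, smul_add]; abel
    | tmul s q =>
      simp [B.del_right, mapCoeff_smul, mapCoeff_baseChange, smul_smul, mul_comm]

variable (N : L →ₗ[ℂ[X]] L)

theorem del_comm (p : L) : N (del L p) = del L (N p) := by simp [del]

theorem baseChange_del_comm (u : R ⊗[ℂ] L) :
    (N.restrictScalars ℂ).baseChange R ((del L).baseChange R u) =
      (del L).baseChange R ((N.restrictScalars ℂ).baseChange R u) := by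
  induction u with
  | zero => simp
  | add x y hx hy => simp [hx, hy]
  | tmul s p => simp [del_comm]

/-- The bracket `(p, q) ↦ [N(p)_λ q]`. -/
noncomputable def SesquilinearBracket.compLeft (B : SesquilinearBracket L) :
    SesquilinearBracket L where
  bracket := B.bracket ∘ₗ N.restrictScalars ℂ
  del_left p q := by simp [del_comm, B.del_left]
  del_right p q := by simp [B.del_right]

/-- The deformed bracket `[p_λ q]_N = [N(p)_λ q] + [p_λ N(q)] - N([p_λ q])`. -/
noncomputable def SesquilinearBracket.deform (B : SesquilinearBracket L) :
    SesquilinearBracket L where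
  bracket := LinearMap.mk₂ ℂ
    (fun p q => B.bracket (N p) q + B.bracket p (N q)
      - (N.restrictScalars ℂ).baseChange ℂ[X] (B.bracket p q))
    (by intros; simp only [map_add, LinearMap.add_apply]; abel)
    (by intro c p q; rw [← LinearMap.restrictScalars_apply ℂ N, map_smul]; simp [smul_add, smul_sub])
    (by intros; simp only [map_add]; abel)
    (by intro c p q; rw [← LinearMap.restrictScalars_apply ℂ N q,
          ← LinearMap.restrictScalars_apply ℂ N (c • q), map_smul]; simp [smul_add, smul_sub])
  del_left p q := by
    simp only [LinearMap.mk₂_apply, del_comm, B.del_left, map_neg, map_smul, smul_sub, smul_add]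
    abel
  del_right p q := by
    simp only [LinearMap.mk₂_apply, del_comm, B.del_right, map_add, map_sub, map_smul, smul_sub,
      smul_add, baseChange_del_comm]
    abel

theorem SesquilinearBracket.extend_deform (B : SesquilinearBracket L) (a : R)
    (u v : R ⊗[ℂ] L) :
    extend (B.deform N).bracket a u v =
      extend B.bracket a ((N.restrictScalars ℂ).baseChange R u) v
      + extend B.bracket a u ((N.restrictScalars ℂ).baseChange R v)
      - (N.restrictScalars ℂ).baseChange R (extend B.bracket a u v) := by
  induction u with
  | zero => simp
  | add x y hx hy => simp only [map_add, LinearMap.add_apply, hx, hy]; abel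
  | tmul r p =>
    induction v with
    | zero => simp
    | add x y hx hy => simp only [map_add, hx, hy]; abel
    | tmul s q =>
      simp [SesquilinearBracket.deform, mapCoeff_baseChange, smul_add, smul_sub]

/-- The `ℂ[∂]`-linear map `N` is a Nijenhuis operator:
`[N(p)_λ N(q)] = N([N(p)_λ q] + [p_λ N(q)] - N([p_λ q]))`. -/
def LieConformalAlgebra.IsNijenhuis (A : LieConformalAlgebra L) (N : L →ₗ[ℂ[X]] L) : Prop :=
  ∀ p q, A.bracket (N p) (N q) =
    (N.restrictScalars ℂ).baseChange ℂ[X]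
      (A.bracket (N p) q + A.bracket p (N q)
        - (N.restrictScalars ℂ).baseChange ℂ[X] (A.bracket p q))

theorem LieConformalAlgebra.IsNijenhuis.extend {A : LieConformalAlgebra L} {N : L →ₗ[ℂ[X]] L}
    (hN : A.IsNijenhuis N) (a : R) (u v : R ⊗[ℂ] L) :
    extend A.bracket a ((N.restrictScalars ℂ).baseChange R u)
        ((N.restrictScalars ℂ).baseChange R v) =
      (N.restrictScalars ℂ).baseChange R (extend (A.deform N).bracket a u v) := by
  induction u with
  | zero => simp
  | add x y hx hy => simp [hx, hy]
  | tmul r p =>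
    induction v with
    | zero => simp
    | add x y hx hy => simp only [map_add, hx, hy]
    | tmul s q =>
      have := hN p q
      simp [SesquilinearBracket.deform, this, mapCoeff_baseChange]

theorem LieConformalAlgebra.jacobi_extend (A : LieConformalAlgebra L)
    (u v w : MvPolynomial (Fin 2) ℂ ⊗[ℂ] L) :
    extend A.bracket (MvPolynomial.X 0) u (extend A.bracket (MvPolynomial.X 1) v w) =
      extend A.bracket (MvPolynomial.X 0 + MvPolynomial.X 1)
        (extend A.bracket (MvPolynomial.X 0) u v) w +
      extend A.bracket (MvPolynomial.X 1) v (extend A.bracket (MvPolynomial.X 0) u w) := by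
  have one (r : MvPolynomial (Fin 2) ℂ) (p : L) : r ⊗ₜ[ℂ] p = r • (1 ⊗ₜ[ℂ] p) := by
    simp [TensorProduct.smul_tmul']
  induction u with
  | zero => simp
  | add x y hx hy => simp only [map_add, LinearMap.add_apply, hx, hy]; abel
  | tmul r p =>
    induction v with
    | zero => simp
    | add x y hx hy => simp only [map_add, LinearMap.add_apply, hx, hy]; abel
    | tmul s q =>
      induction w with
      | zero => simp
      | add x y hx hy => simp only [map_add, hx, hy]; abel
      | tmul t w =>
        rw [one r, one s, one t]
        simp only [map_smul, LinearMap.smul_apply, A.jacobi, smul_add, smul_smul]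
        congr 2 <;> ring

theorem dagger_baseChange (z : ℂ[X] ⊗[ℂ] L) :
    dagger L ((N.restrictScalars ℂ).baseChange ℂ[X] z) =
      (N.restrictScalars ℂ).baseChange ℂ[X] (dagger L z) := by
  induction z with
  | zero => simp
  | add x y hx hy => simp [hx, hy]
  | tmul P c =>
    simp only [dagger, LinearMap.baseChange_tmul, TensorProduct.lift.tmul, LinearMap.mk₂_apply]
    induction P using Polynomial.induction_on' with
    | add P Q hP hQ => simp only [map_add, LinearMap.add_apply, hP, hQ]
    | monomial n a =>
      simp only [Polynomial.aeval_monomial, Module.End.mul_apply, Module.algebraMap_end_apply,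
        LinearMap.map_smul_of_tower]
      congr 1
      induction n with
      | zero => simp
      | succ n ih =>
        simp only [pow_succ', Module.End.mul_apply, ih]
        simp [baseChange_del_comm]

theorem jacobi_of_nijenhuis {R M : Type*} [CommRing R] [AddCommGroup M] [Module R M]
    (B C D : M →ₗ[R] M →ₗ[R] M) (n : M →ₗ[R] M)
    (hB : ∀ u v, B (n u) (n v) = n (B (n u) v + B u (n v) - n (B u v)))
    (hC : ∀ u v, C (n u) (n v) = n (C (n u) v + C u (n v) - n (C u v)))
    (hD : ∀ u v, D (n u) (n v) = n (D (n u) v + D u (n v) - n (D u v)))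
    (J : ∀ u v w, B u (C v w) = D (B u v) w + C v (B u w)) (u v w : M) :
    B (n u) (C (n v) w + C v (n w) - n (C v w)) + B u (n (C (n v) w + C v (n w) - n (C v w)))
        - n (B u (C (n v) w + C v (n w) - n (C v w))) =
      (D (n (B (n u) v + B u (n v) - n (B u v))) w + D (B (n u) v + B u (n v) - n (B u v)) (n w)
        - n (D (B (n u) v + B u (n v) - n (B u v)) w)) +
      (C (n v) (B (n u) w + B u (n w) - n (B u w)) + C v (n (B (n u) w + B u (n w) - n (B u w)))
        - n (C v (B (n u) w + B u (n w) - n (B u w)))) := by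
  rw [← hC v w, ← hB u v, ← hB u w]
  simp only [map_add, map_sub, LinearMap.add_apply, LinearMap.sub_apply, hB u (C v w),
    hD (B u v) w, hC v (B u w), J]
  abel

theorem LieConformalAlgebra.IsNijenhuis.jacobi_deform {A : LieConformalAlgebra L}
    {N : L →ₗ[ℂ[X]] L} (hN : A.IsNijenhuis N) (a b : R)
    (J : ∀ u v w : R ⊗[ℂ] L, LieConformal.extend A.bracket a u (LieConformal.extend A.bracket b v w) =
      LieConformal.extend A.bracket (a + b) (LieConformal.extend A.bracket a u v) w +
      LieConformal.extend A.bracket b v (LieConformal.extend A.bracket a u w)) (u v w : R ⊗[ℂ] L) :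
    LieConformal.extend (A.deform N).bracket a u (LieConformal.extend (A.deform N).bracket b v w) =
      LieConformal.extend (A.deform N).bracket (a + b)
        (LieConformal.extend (A.deform N).bracket a u v) w +
      LieConformal.extend (A.deform N).bracket b v
        (LieConformal.extend (A.deform N).bracket a u w) := by
  have hn := fun c x y => (hN.extend (R := R) c x y).trans (congrArg _ (A.extend_deform N c x y))
  simp only [A.extend_deform]
  exact jacobi_of_nijenhuis _ _ _ _ (hn a) (hn b) (hn (a + b)) J u v w

/-- The induced Lie conformal algebra `(L, [·_λ ·]_N)` of a Nijenhuis operator `N`. -/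
noncomputable def LieConformalAlgebra.deformed (A : LieConformalAlgebra L) (N : L →ₗ[ℂ[X]] L)
    (hN : A.IsNijenhuis N) : LieConformalAlgebra L where
  toSesquilinearBracket := A.deform N
  skew p q := by
    simp only [SesquilinearBracket.deform, LinearMap.mk₂_apply, map_sub, map_add,
      dagger_baseChange]
    rw [A.skew p q, A.skew (N p) q, A.skew p (N q)]
    simp only [map_neg]
    abel
  jacobi p q r := by
    exact hN.jacobi_deform _ _ A.jacobi_extend _ _ _

end Nijenhuis

end Algebras

section Cochains
variable (L : Type*) [AddCommGroup L] [Module ℂ L] [Module ℂ[X] L] [IsScalarTower ℂ ℂ[X] L]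

/-- `L[λ_1, …, λ_n]`. -/
abbrev LPoly (n : ℕ) : Type _ := MvPolynomial (Fin n) ℂ ⊗[ℂ] L

/-- The operator `∂ + λ_1 + … + λ_n` on `L[λ_1, …, λ_n]`. -/
noncomputable def total (n : ℕ) : LPoly L n →ₗ[MvPolynomial (Fin n) ℂ] LPoly L n :=
  (del L).baseChange (MvPolynomial (Fin n) ℂ) +
    (∑ k, MvPolynomial.X k : MvPolynomial (Fin n) ℂ) • LinearMap.id

/-- The values of `n`-cochains: `L[λ_1, …, λ_n]` with the relation `λ_1 + … + λ_n = -∂` imposed.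
For `n ≥ 1` this is `L[λ_1, …, λ_{n-1}]`, the last variable being `λ_n = -∂ - λ_1 - … - λ_{n-1}`
(see `Values.ofReduced` and the two theorems after it, which show that it is a bijection); for
`n = 0` it is `L / ∂L`. -/
def Values (n : ℕ) : Type _ := LPoly L n ⧸ LinearMap.range (total L n)

noncomputable instance (n : ℕ) : AddCommGroup (Values L n) :=
  inferInstanceAs (AddCommGroup (LPoly L n ⧸ LinearMap.range (total L n)))

noncomputable instance (n : ℕ) : Module (MvPolynomial (Fin n) ℂ) (Values L n) :=
  inferInstanceAs (Module (MvPolynomial (Fin n) ℂ) (LPoly L n ⧸ LinearMap.range (total L n)))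

noncomputable instance (n : ℕ) : Module ℂ (Values L n) :=
  inferInstanceAs (Module ℂ (LPoly L n ⧸ LinearMap.range (total L n)))

instance (n : ℕ) : IsScalarTower ℂ (MvPolynomial (Fin n) ℂ) (Values L n) :=
  inferInstanceAs
    (IsScalarTower ℂ (MvPolynomial (Fin n) ℂ) (LPoly L n ⧸ LinearMap.range (total L n)))

variable {L}

theorem total_apply (n : ℕ) (u : LPoly L n) : total L n u =
    (del L).baseChange (MvPolynomial (Fin n) ℂ) u +
      (∑ k, MvPolynomial.X k : MvPolynomial (Fin n) ℂ) • u := rfl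

/-- The class of a polynomial. -/
noncomputable def Values.mk (n : ℕ) : LPoly L n →ₗ[MvPolynomial (Fin n) ℂ] Values L n :=
  (LinearMap.range (total L n)).mkQ

theorem Values.mk_surjective (n : ℕ) : Function.Surjective (Values.mk (L := L) n) :=
  Submodule.mkQ_surjective _

theorem Values.mk_total (n : ℕ) (u : LPoly L n) : Values.mk n (total L n u) = 0 :=
  (Submodule.Quotient.mk_eq_zero _).2 ⟨u, rfl⟩

/-- Maps out of `Values L n`. -/
noncomputable def Values.lift {n : ℕ} {W : Type*} [AddCommGroup W] [Module ℂ W]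
    (φ : LPoly L n →ₗ[ℂ] W) (h : ∀ u, φ (total L n u) = 0) : Values L n →ₗ[ℂ] W :=
  (((LinearMap.range (total L n)).restrictScalars ℂ).liftQ φ (by rintro _ ⟨u, rfl⟩; exact h u)) ∘ₗ
    (Submodule.Quotient.restrictScalarsEquiv ℂ (LinearMap.range (total L n))).symm.toLinearMap

theorem Values.lift_mk {n : ℕ} {W : Type*} [AddCommGroup W] [Module ℂ W]
    (φ : LPoly L n →ₗ[ℂ] W) (h : ∀ u, φ (total L n u) = 0) (u : LPoly L n) :
    Values.lift φ h (Values.mk n u) = φ u := rfl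

/-- The substitution of polynomials for the variables, when it preserves the sum of all variables. -/
noncomputable def Values.subst {m n : ℕ}
    (e : MvPolynomial (Fin m) ℂ →ₐ[ℂ] MvPolynomial (Fin n) ℂ)
    (he : e (∑ k, MvPolynomial.X k) = ∑ k, MvPolynomial.X k) : Values L m →ₗ[ℂ] Values L n :=
  Values.lift ((Values.mk n).restrictScalars ℂ ∘ₗ mapCoeff e) (fun u => by
    have : mapCoeff e (total L m u) = total L n (mapCoeff e u) := by
      simp only [total_apply, map_add, mapCoeff_baseChange, mapCoeff_smul, he]
    simp [this, Values.mk_total])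

theorem Values.subst_mk {m n : ℕ} (e : MvPolynomial (Fin m) ℂ →ₐ[ℂ] MvPolynomial (Fin n) ℂ)
    (he : e (∑ k, MvPolynomial.X k) = ∑ k, MvPolynomial.X k) (u : LPoly L m) :
    Values.subst e he (Values.mk m u) = Values.mk n (mapCoeff e u) := rfl

theorem Values.subst_smul {m n : ℕ} (e : MvPolynomial (Fin m) ℂ →ₐ[ℂ] MvPolynomial (Fin n) ℂ)
    (he : e (∑ k, MvPolynomial.X k) = ∑ k, MvPolynomial.X k) (P : MvPolynomial (Fin m) ℂ)
    (v : Values L m) : Values.subst e he (P • v) = e P • Values.subst e he v := by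
  obtain ⟨u, rfl⟩ := Values.mk_surjective m v
  rw [← map_smul, Values.subst_mk, Values.subst_mk, mapCoeff_smul, map_smul]

/-- The substitution `λ_k ↦ λ_{σ k}`. -/
noncomputable def Values.perm {n : ℕ} (σ : Equiv.Perm (Fin n)) : Values L n →ₗ[ℂ] Values L n :=
  Values.subst (MvPolynomial.rename σ) (by
    simp only [map_sum, MvPolynomial.rename_X]
    exact Equiv.sum_comp σ (fun k => (MvPolynomial.X k : MvPolynomial (Fin n) ℂ)))

/-- A `ℂ[∂]`-linear map `N` applied to all coefficients. -/
noncomputable def Values.map (N : L →ₗ[ℂ[X]] L) (n : ℕ) : Values L n →ₗ[ℂ] Values L n :=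
  Values.lift
    ((Values.mk n ∘ₗ (N.restrictScalars ℂ).baseChange (MvPolynomial (Fin n) ℂ)).restrictScalars ℂ)
    (fun u => by
      have : (N.restrictScalars ℂ).baseChange (MvPolynomial (Fin n) ℂ) (total L n u) =
          total L n ((N.restrictScalars ℂ).baseChange (MvPolynomial (Fin n) ℂ) u) := by
        simp only [total_apply, map_add, map_smul, baseChange_del_comm]
      simp [this, Values.mk_total])

theorem Values.map_mk (N : L →ₗ[ℂ[X]] L) (n : ℕ) (u : LPoly L n) :
    Values.map N n (Values.mk n u) =
      Values.mk n ((N.restrictScalars ℂ).baseChange (MvPolynomial (Fin n) ℂ) u) := rfl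

theorem Values.map_smul (N : L →ₗ[ℂ[X]] L) (n : ℕ) (P : MvPolynomial (Fin n) ℂ)
    (v : Values L n) : Values.map N n (P • v) = P • Values.map N n v := by
  obtain ⟨u, rfl⟩ := Values.mk_surjective n v
  rw [← _root_.map_smul, Values.map_mk, Values.map_mk, _root_.map_smul, _root_.map_smul]

theorem Values.map_perm (N : L →ₗ[ℂ[X]] L) (n : ℕ) (σ : Equiv.Perm (Fin n))
    (v : Values L n) : Values.map N n (Values.perm σ v) = Values.perm σ (Values.map N n v) := by
  obtain ⟨u, rfl⟩ := Values.mk_surjective n v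
  rw [Values.map_mk, Values.perm, Values.subst_mk, Values.map_mk, Values.subst_mk,
    mapCoeff_baseChange]

theorem SesquilinearBracket.extend_total (B : SesquilinearBracket L) {n : ℕ} (i : Fin (n + 1))
    (p : L) (u : LPoly L n) :
    extend B.bracket (MvPolynomial.X i) (1 ⊗ₜ p)
        (mapCoeff (MvPolynomial.rename i.succAbove) (total L n u)) =
      total L (n + 1) (extend B.bracket (MvPolynomial.X i) (1 ⊗ₜ p)
        (mapCoeff (MvPolynomial.rename i.succAbove) u)) := by
  rw [total_apply, total_apply, LinearMap.map_add, mapCoeff_baseChange, mapCoeff_smul,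
    LinearMap.map_add, B.extend_del_right, LinearMap.map_smul, map_sum,
    Fin.sum_univ_succAbove _ i, add_smul, add_assoc]
  simp only [MvPolynomial.rename_X]

/-- For `p : L`, the map `u ↦ [p_{λ_i} u]`, where `u` is a value of an `n`-cochain, written in the
variables `λ_0, …, λ_n` without `λ_i`. -/
noncomputable def SesquilinearBracket.act (B : SesquilinearBracket L) {n : ℕ} (i : Fin (n + 1)) :
    L →ₗ[ℂ] Values L n →ₗ[ℂ] Values L (n + 1) where
  toFun p := Values.lift
    (((Values.mk (n + 1)) ∘ₗ extend B.bracket (MvPolynomial.X i) (1 ⊗ₜ p)).restrictScalars ℂ ∘ₗ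
      mapCoeff (MvPolynomial.rename i.succAbove)) (fun u => by
        rw [LinearMap.comp_apply, LinearMap.restrictScalars_apply, LinearMap.comp_apply,
          B.extend_total, Values.mk_total])
  map_add' p q := LinearMap.ext fun v => by
    obtain ⟨u, rfl⟩ := Values.mk_surjective n v
    simp only [LinearMap.add_apply, Values.lift_mk, LinearMap.comp_apply,
      LinearMap.restrictScalars_apply, TensorProduct.tmul_add, LinearMap.map_add]
  map_smul' c p := LinearMap.ext fun v => by
    obtain ⟨u, rfl⟩ := Values.mk_surjective n v
    simp only [LinearMap.smul_apply, Values.lift_mk, LinearMap.comp_apply, RingHom.id_apply,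
      LinearMap.restrictScalars_apply, TensorProduct.tmul_smul, LinearMap.map_smul_of_tower]

theorem SesquilinearBracket.act_mk (B : SesquilinearBracket L) {n : ℕ} (i : Fin (n + 1)) (p : L)
    (u : LPoly L n) : B.act i p (Values.mk n u) = Values.mk (n + 1)
      (extend B.bracket (MvPolynomial.X i) (1 ⊗ₜ p)
        (mapCoeff (MvPolynomial.rename i.succAbove) u)) := rfl

theorem SesquilinearBracket.act_smul (B : SesquilinearBracket L) {n : ℕ} (i : Fin (n + 1)) (p : L)
    (P : MvPolynomial (Fin n) ℂ) (v : Values L n) :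
    B.act i p (P • v) = MvPolynomial.rename i.succAbove P • B.act i p v := by
  obtain ⟨u, rfl⟩ := Values.mk_surjective n v
  rw [← map_smul, B.act_mk, B.act_mk, mapCoeff_smul, map_smul, map_smul]

theorem SesquilinearBracket.act_del (B : SesquilinearBracket L) {n : ℕ} (i : Fin (n + 1)) (p : L)
    (v : Values L n) :
    B.act i (del L p) v = -((MvPolynomial.X i : MvPolynomial (Fin (n + 1)) ℂ) • B.act i p v) := by
  obtain ⟨u, rfl⟩ := Values.mk_surjective n v
  rw [B.act_mk, B.act_mk, ← map_smul, ← map_neg, ← B.extend_del_left]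
  simp

theorem SesquilinearBracket.perm_act (B : SesquilinearBracket L) {n : ℕ}
    (σ : Equiv.Perm (Fin (n + 1))) (τ : Equiv.Perm (Fin n)) (i : Fin (n + 1))
    (h : ∀ k, σ (i.succAbove k) = (σ i).succAbove (τ k)) (p : L) (v : Values L n) :
    Values.perm σ (B.act i p v) = B.act (σ i) p (Values.perm τ v) := by
  obtain ⟨u, rfl⟩ := Values.mk_surjective n v
  have e : (MvPolynomial.rename σ).comp (MvPolynomial.rename (R := ℂ) i.succAbove) =
    (MvPolynomial.rename (σ i).succAbove).comp (MvPolynomial.rename τ) := by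
    ext k; simp [h]
  rw [B.act_mk, Values.perm, Values.perm, Values.subst_mk, Values.subst_mk, B.act_mk,
    mapCoeff_extend, mapCoeff_mapCoeff, mapCoeff_mapCoeff, e]
  simp

theorem exists_perm_succAbove {n : ℕ} (σ : Equiv.Perm (Fin (n + 1))) (i : Fin (n + 1)) :
    ∃ τ : Equiv.Perm (Fin n), (∀ k, σ (i.succAbove k) = (σ i).succAbove (τ k)) ∧
      ((Equiv.Perm.sign τ : ℤˣ) : ℤ) = Equiv.Perm.sign σ * (-1) ^ (i : ℕ) * (-1) ^ (σ i : ℕ) := by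
  let ρ : Equiv.Perm (Fin (n + 1)) := (σ i).cycleRange * σ * i.cycleRange.symm
  obtain ⟨⟨a, τ⟩, hτ⟩ := Equiv.Perm.decomposeFin.symm.surjective ρ
  have h0 : ρ 0 = 0 := by simp [ρ]
  have ha : a = 0 := by rw [← hτ] at h0; simpa using h0
  subst ha
  refine ⟨τ, fun k => ?_, ?_⟩
  · have : ρ k.succ = (τ k).succ := by rw [← hτ]; simp
    have h2 := congrArg (σ i).cycleRange.symm this
    simpa [ρ] using h2
  · have := congrArg Equiv.Perm.sign hτ
    rw [Equiv.Perm.decomposeFin.symm_sign] at this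
    simp only [if_true, one_mul] at this
    rw [this]
    simp [ρ, Fin.sign_cycleRange]
    ring

end Cochains

section Differentials
variable (L : Type*) [AddCommGroup L] [Module ℂ L] [Module ℂ[X] L] [IsScalarTower ℂ ℂ[X] L]

/-- The space `C^n(L, L)` of `n`-cochains: `ℂ`-multilinear maps
`f_{λ_0, …, λ_{n-1}} : L × … × L → L[λ_0, …, λ_{n-1}] / (∂ + λ_0 + … + λ_{n-1})` that are conformally
sesquilinear, `f(…, ∂p_k, …) = -λ_k f(…, p_k, …)`, and conformally skew-symmetric,
`f_{λ_{σ 0}, λ_{σ 1}, …}(p_{σ 0}, p_{σ 1}, …) = sgn(σ) f_{λ_0, λ_1, …}(p_0, p_1, …)`. In degree `0`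
it is `L / ∂L`. -/
def Cochain (n : ℕ) : Submodule ℂ (MultilinearMap ℂ (fun _ : Fin n => L) (Values L n)) where
  carrier := {f |
    (∀ (p : Fin n → L) (k : Fin n), f (Function.update p k (del L (p k))) =
      -((MvPolynomial.X k : MvPolynomial (Fin n) ℂ) • f p)) ∧
    (∀ (σ : Equiv.Perm (Fin n)) (p : Fin n → L),
      Values.perm σ (f (p ∘ σ)) = (Equiv.Perm.sign σ : ℤ) • f p)}
  zero_mem' := by simp
  add_mem' {f g} hf hg := by
    refine ⟨fun p k => ?_, fun σ p => ?_⟩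
    · rw [add_apply, add_apply, hf.1, hg.1, smul_add, neg_add]
    · rw [add_apply, add_apply, map_add, hf.2, hg.2, smul_add]
  smul_mem' c f hf := by
    refine ⟨fun p k => ?_, fun σ p => ?_⟩
    · rw [smul_apply, smul_apply, hf.1, smul_neg, smul_comm]
    · rw [smul_apply, smul_apply, map_smul, hf.2, smul_comm]

variable {L}

/-- `(p_0, …, p_n) ↦ [(p_i)_{λ_i} f_{…, λ_i omitted, …}(…, p_i omitted, …)]`. -/
noncomputable def SesquilinearBracket.actTerm (B : SesquilinearBracket L) {n : ℕ}
    (i : Fin (n + 1)) (f : MultilinearMap ℂ (fun _ : Fin n => L) (Values L n)) :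
    MultilinearMap ℂ (fun _ : Fin (n + 1) => L) (Values L (n + 1)) :=
  LinearMap.uncurryMid (M := fun _ => L) i
    { toFun := fun x => (B.act i x).compMultilinearMap f
      map_add' := fun x y => by ext p; simp
      map_smul' := fun c x => by ext p; simp }

theorem SesquilinearBracket.actTerm_apply (B : SesquilinearBracket L) {n : ℕ}
    (i : Fin (n + 1)) (f : MultilinearMap ℂ (fun _ : Fin n => L) (Values L n))
    (p : Fin (n + 1) → L) :
    B.actTerm i f p = B.act i (p i) (f (fun k => p (i.succAbove k))) := rfl

/-- For `i' = j.succAbove i`, the substitution of `λ_{i'} + λ_j` for the first variable and of the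
`λ_k` with `k ≠ i', j`, in increasing order, for the other ones. -/
noncomputable def mergeVars {m : ℕ} (j : Fin (m + 2)) (i : Fin (m + 1)) :
    MvPolynomial (Fin (m + 1)) ℂ →ₐ[ℂ] MvPolynomial (Fin (m + 2)) ℂ :=
  MvPolynomial.aeval (Fin.cons (MvPolynomial.X (j.succAbove i) + MvPolynomial.X j)
    (fun k => MvPolynomial.X (j.succAbove (i.succAbove k))))

theorem mergeVars_sum {m : ℕ} (j : Fin (m + 2)) (i : Fin (m + 1)) :
    mergeVars j i (∑ k, MvPolynomial.X k) = ∑ k, MvPolynomial.X k := by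
  rw [map_sum, Fin.sum_univ_succ, Fin.sum_univ_succAbove _ j, Fin.sum_univ_succAbove _ i]
  simp only [mergeVars, MvPolynomial.aeval_X, Fin.cons_zero, Fin.cons_succ]
  ring

/-- For `z = ∑ λ^k c_k` in `L[λ]` and `i' = j.succAbove i`: the expression
`∑ a^k f_{λ_{i'} + λ_j, …, λ_{i'} omitted, …, λ_j omitted, …}(c_k, p)` as a function of `p`. -/
noncomputable def insertFirst {m : ℕ} (j : Fin (m + 2)) (i : Fin (m + 1))
    (a : MvPolynomial (Fin (m + 2)) ℂ)
    (f : MultilinearMap ℂ (fun _ : Fin (m + 1) => L) (Values L (m + 1))) :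
    ℂ[X] ⊗[ℂ] L →ₗ[ℂ] MultilinearMap ℂ (fun _ : Fin m => L) (Values L (m + 2)) :=
  TensorProduct.lift (LinearMap.mk₂ ℂ
    (fun P c => (Algebra.lsmul ℂ ℂ (Values L (m + 2)) (Polynomial.aeval a P) ∘ₗ
      Values.subst (mergeVars j i) (mergeVars_sum j i)).compMultilinearMap (f.curryLeft c))
    (fun P Q c => by ext p; simp) (fun r P c => by ext p; simp)
    (fun P c d => by ext p; simp)
    (fun r P c => by
      ext p
      simp only [map_smul, LinearMap.compMultilinearMap_apply, smul_apply,
        LinearMap.comp_apply]))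

theorem insertFirst_tmul {m : ℕ} (j : Fin (m + 2)) (i : Fin (m + 1))
    (a : MvPolynomial (Fin (m + 2)) ℂ)
    (f : MultilinearMap ℂ (fun _ : Fin (m + 1) => L) (Values L (m + 1)))
    (P : ℂ[X]) (c : L) (p : Fin m → L) :
    insertFirst j i a f (P ⊗ₜ c) p = Polynomial.aeval a P •
      Values.subst (mergeVars j i) (mergeVars_sum j i) (f (Fin.cons c p)) := rfl

/-- For `i' = j.succAbove i` (which is `i` itself when `i < j`), the map that sends `(p_0, …, p_n)`
to `f_{λ_{i'} + λ_j, …}([(p_{i'})_{λ_{i'}} p_j], …)`, the dots standing for the other variables and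
arguments in increasing order. -/
noncomputable def SesquilinearBracket.bracketTerm (B : SesquilinearBracket L) {m : ℕ}
    (j : Fin (m + 2)) (i : Fin (m + 1))
    (f : MultilinearMap ℂ (fun _ : Fin (m + 1) => L) (Values L (m + 1))) :
    MultilinearMap ℂ (fun _ : Fin (m + 2) => L) (Values L (m + 2)) :=
  LinearMap.uncurryMid (M := fun _ => L) j
    { toFun := fun y => LinearMap.uncurryMid (M := fun _ => L) i
        (insertFirst j i (MvPolynomial.X (j.succAbove i)) f ∘ₗ B.bracket.flip y)
      map_add' := fun x y => by ext p; simp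
      map_smul' := fun c x => by ext p; simp }

theorem SesquilinearBracket.bracketTerm_apply (B : SesquilinearBracket L) {m : ℕ}
    (j : Fin (m + 2)) (i : Fin (m + 1))
    (f : MultilinearMap ℂ (fun _ : Fin (m + 1) => L) (Values L (m + 1))) (p : Fin (m + 2) → L) :
    B.bracketTerm j i f p =
      insertFirst j i (MvPolynomial.X (j.succAbove i)) f
        (B.bracket (p (j.succAbove i)) (p j)) (fun k => p (j.succAbove (i.succAbove k))) := rfl

/-- `∑_i (-1)^i [(p_i)_{λ_i} f(…, p_i omitted, …)]`, with `i` counted from `0`. -/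
noncomputable def SesquilinearBracket.actSum (B : SesquilinearBracket L) {n : ℕ}
    (f : MultilinearMap ℂ (fun _ : Fin n => L) (Values L n)) :
    MultilinearMap ℂ (fun _ : Fin (n + 1) => L) (Values L (n + 1)) :=
  ∑ i : Fin (n + 1), ((-1 : ℤ) ^ (i : ℕ)) • B.actTerm i f

/-- `∑_{i<j} (-1)^{i+j} f_{λ_i + λ_j, …}([(p_i)_{λ_i} p_j], …)`, with `i`, `j` counted from `0`. -/
noncomputable def SesquilinearBracket.bracketSum (B : SesquilinearBracket L) :
    {n : ℕ} → MultilinearMap ℂ (fun _ : Fin n => L) (Values L n) →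
      MultilinearMap ℂ (fun _ : Fin (n + 1) => L) (Values L (n + 1))
  | 0, _ => 0
  | m + 1, f => ∑ j : Fin (m + 2), ∑ i : Fin (m + 1) with i.castSucc < j,
      ((-1 : ℤ) ^ ((i : ℕ) + (j : ℕ))) • B.bracketTerm j i f

theorem SesquilinearBracket.actSum_apply (B : SesquilinearBracket L) {n : ℕ}
    (f : MultilinearMap ℂ (fun _ : Fin n => L) (Values L n)) (p : Fin (n + 1) → L) :
    B.actSum f p = ∑ i : Fin (n + 1), ((-1 : ℤ) ^ (i : ℕ)) • B.actTerm i f p := by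
  simp [actSum]

theorem SesquilinearBracket.actSum_mem (B : SesquilinearBracket L) {n : ℕ}
    {f : MultilinearMap ℂ (fun _ : Fin n => L) (Values L n)} (hf : f ∈ Cochain L n) :
    B.actSum f ∈ Cochain L (n + 1) := by
  refine ⟨fun p k => ?_, fun σ p => ?_⟩
  · rw [B.actSum_apply, B.actSum_apply, Finset.smul_sum, ← Finset.sum_neg_distrib]
    refine Finset.sum_congr rfl fun i _ => ?_
    rw [smul_comm (MvPolynomial.X k : MvPolynomial (Fin (n + 1)) ℂ), ← smul_neg]
    congr 1
    rw [B.actTerm_apply, B.actTerm_apply]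
    rcases eq_or_ne k i with rfl | hki
    · simp [B.act_del]
    · obtain ⟨l, rfl⟩ := Fin.exists_succAbove_eq hki
      have h : (fun q => Function.update p (i.succAbove l) (del L (p (i.succAbove l)))
          (i.succAbove q)) = Function.update (fun q => p (i.succAbove q)) l
            (del L (p (i.succAbove l))) := by
        ext q; simp [Function.update_apply]
      rw [h, hf.1 (fun q => p (i.succAbove q)) l, Function.update_of_ne (Fin.succAbove_ne i l).symm, map_neg, B.act_smul,
        MvPolynomial.rename_X]
  · rw [B.actSum_apply, B.actSum_apply, map_sum, Finset.smul_sum,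
      ← Equiv.sum_comp σ (fun i => (Equiv.Perm.sign σ : ℤ) • ((-1 : ℤ) ^ (i : ℕ)) • B.actTerm i f p)]
    refine Finset.sum_congr rfl fun i _ => ?_
    obtain ⟨τ, h1, h2⟩ := exists_perm_succAbove σ i
    rw [B.actTerm_apply, B.actTerm_apply, map_zsmul, B.perm_act σ τ i h1]
    have e : (fun k => (p ∘ σ) (i.succAbove k)) = (fun k => p ((σ i).succAbove k)) ∘ τ := by
      ext k; simp [h1]
    rw [e, hf.2, map_zsmul, Function.comp_apply, smul_smul, smul_smul, h2]
    congr 1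
    have : ((-1 : ℤ) ^ (i : ℕ)) * (-1) ^ (i : ℕ) = 1 := by rw [← mul_pow]; simp
    linear_combination ((Equiv.Perm.sign σ : ℤ) * (-1) ^ (σ i : ℕ)) * this

theorem subst_congr {m n : ℕ} {e e' : MvPolynomial (Fin m) ℂ →ₐ[ℂ] MvPolynomial (Fin n) ℂ}
    (h : e = e') (he : e (∑ k, MvPolynomial.X k) = ∑ k, MvPolynomial.X k)
    (he' : e' (∑ k, MvPolynomial.X k) = ∑ k, MvPolynomial.X k) (v : Values L m) :
    Values.subst e he v = Values.subst e' he' v := by subst h; rfl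

theorem mergeVars_swap {m : ℕ} (j : Fin (m + 2)) (i : Fin (m + 1)) :
    mergeVars (j.succAbove i) (i.predAbove j) = mergeVars j i := by
  simp only [mergeVars, Fin.succAbove_succAbove_predAbove,
    Fin.succAbove_succAbove_succAbove_predAbove,
    add_comm (MvPolynomial.X j : MvPolynomial (Fin (m + 2)) ℂ)]

theorem insertFirst_X_smul {m : ℕ} (j : Fin (m + 2)) (i : Fin (m + 1))
    (a : MvPolynomial (Fin (m + 2)) ℂ)
    (f : MultilinearMap ℂ (fun _ : Fin (m + 1) => L) (Values L (m + 1)))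
    (z : ℂ[X] ⊗[ℂ] L) (p : Fin m → L) :
    insertFirst j i a f ((Polynomial.X : ℂ[X]) • z) p = a • insertFirst j i a f z p := by
  induction z with
  | zero => simp
  | add x y hx hy => rw [smul_add, map_add, map_add, add_apply, add_apply, hx, hy, smul_add]
  | tmul P c =>
    rw [TensorProduct.smul_tmul', insertFirst_tmul, insertFirst_tmul, smul_smul]
    simp

theorem insertFirst_del {m : ℕ} (j : Fin (m + 2)) (i : Fin (m + 1))
    (a : MvPolynomial (Fin (m + 2)) ℂ)
    {f : MultilinearMap ℂ (fun _ : Fin (m + 1) => L) (Values L (m + 1))}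
    (hf : f ∈ Cochain L (m + 1)) (z : ℂ[X] ⊗[ℂ] L) (p : Fin m → L) :
    insertFirst j i a f ((del L).baseChange ℂ[X] z) p =
      -((MvPolynomial.X (j.succAbove i) + MvPolynomial.X j : MvPolynomial (Fin (m + 2)) ℂ) •
        insertFirst j i a f z p) := by
  induction z with
  | zero => simp
  | add x y hx hy => rw [map_add, map_add, map_add, add_apply, add_apply, hx, hy, smul_add, neg_add]
  | tmul P c =>
    have h := hf.1 (Fin.cons c p) 0
    rw [Fin.update_cons_zero, Fin.cons_zero] at h
    rw [LinearMap.baseChange_tmul, insertFirst_tmul, insertFirst_tmul, h, map_neg, smul_neg,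
      Values.subst_smul, smul_comm]
    simp [mergeVars]

theorem insertFirst_dagger {m : ℕ} (j : Fin (m + 2)) (i : Fin (m + 1))
    {f : MultilinearMap ℂ (fun _ : Fin (m + 1) => L) (Values L (m + 1))}
    (hf : f ∈ Cochain L (m + 1)) (z : ℂ[X] ⊗[ℂ] L) (p : Fin m → L) :
    insertFirst j i (MvPolynomial.X j) f (dagger L z) p =
      insertFirst j i (MvPolynomial.X (j.succAbove i)) f z p := by
  induction z with
  | zero => simp
  | add x y hx hy => rw [map_add, map_add, map_add, add_apply, add_apply, hx, hy]
  | tmul P c =>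
    rw [dagger, TensorProduct.lift.tmul, LinearMap.mk₂_apply]
    set D : Module.End ℂ (ℂ[X] ⊗[ℂ] L) :=
      -(Polynomial.X : ℂ[X]) • (LinearMap.id : ℂ[X] ⊗[ℂ] L →ₗ[ℂ] ℂ[X] ⊗[ℂ] L)
        - ((del L).baseChange ℂ[X]).restrictScalars ℂ with hD
    have hDz : ∀ z, insertFirst j i (MvPolynomial.X j) f (D z) p =
        (MvPolynomial.X (j.succAbove i) : MvPolynomial (Fin (m + 2)) ℂ) •
          insertFirst j i (MvPolynomial.X j) f z p := fun z => by
      have : D z = -((Polynomial.X : ℂ[X]) • z + (del L).baseChange ℂ[X] z) := by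
        simp [hD]; abel
      rw [this, map_neg, map_add, neg_apply, add_apply, insertFirst_X_smul,
        insertFirst_del j i _ hf, add_smul]
      abel
    induction P using Polynomial.induction_on' with
    | add P Q hP hQ =>
      rw [map_add, LinearMap.add_apply, map_add, add_apply, hP, hQ, TensorProduct.add_tmul,
        map_add, add_apply]
    | monomial n r =>
      rw [Polynomial.aeval_monomial, Module.End.mul_apply, Module.algebraMap_end_apply, map_smul,
        smul_apply]
      have : insertFirst j i (MvPolynomial.X j) f ((D ^ n) (1 ⊗ₜ c)) p =
          (MvPolynomial.X (j.succAbove i) : MvPolynomial (Fin (m + 2)) ℂ) ^ n •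
            insertFirst j i (MvPolynomial.X j) f (1 ⊗ₜ c) p := by
        induction n with
        | zero => simp
        | succ n ih => rw [pow_succ', Module.End.mul_apply, hDz, ih, smul_smul, ← pow_succ']
      rw [this, insertFirst_tmul, insertFirst_tmul, Polynomial.aeval_monomial, map_one, one_smul,
        ← Algebra.smul_def, smul_assoc]

theorem LieConformalAlgebra.bracketTerm_swap (A : LieConformalAlgebra L) {m : ℕ}
    (j : Fin (m + 2)) (i : Fin (m + 1))
    {f : MultilinearMap ℂ (fun _ : Fin (m + 1) => L) (Values L (m + 1))}
    (hf : f ∈ Cochain L (m + 1)) (p : Fin (m + 2) → L) :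
    A.bracketTerm (j.succAbove i) (i.predAbove j) f p = -A.bracketTerm j i f p := by
  have e : ∀ a z q, insertFirst (j.succAbove i) (i.predAbove j) a f z q =
      insertFirst j i a f z q := fun a z q => by
    induction z with
    | zero => simp
    | add x y hx hy => rw [map_add, map_add, add_apply, add_apply, hx, hy]
    | tmul P c =>
      rw [insertFirst_tmul, insertFirst_tmul]
      exact congrArg _ (subst_congr (mergeVars_swap j i) _ _ _)
  rw [SesquilinearBracket.bracketTerm_apply, SesquilinearBracket.bracketTerm_apply, e]
  simp only [Fin.succAbove_succAbove_predAbove, Fin.succAbove_succAbove_succAbove_predAbove]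
  rw [A.skew (p j), map_neg, neg_apply, insertFirst_dagger j i hf]

theorem insertFirst_perm {m : ℕ} (σ : Equiv.Perm (Fin (m + 2))) (j : Fin (m + 2))
    (i : Fin (m + 1)) (τ : Equiv.Perm (Fin (m + 1))) (ρ : Equiv.Perm (Fin m))
    (hτ : ∀ k, σ (j.succAbove k) = (σ j).succAbove (τ k))
    (hρ : ∀ k, τ (i.succAbove k) = (τ i).succAbove (ρ k))
    {f : MultilinearMap ℂ (fun _ : Fin (m + 1) => L) (Values L (m + 1))}
    (hf : f ∈ Cochain L (m + 1)) (a : MvPolynomial (Fin (m + 2)) ℂ) (z : ℂ[X] ⊗[ℂ] L)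
    (p : Fin m → L) :
    Values.perm σ (insertFirst j i a f z (p ∘ ρ)) =
      (Equiv.Perm.sign ρ : ℤ) •
        insertFirst (σ j) (τ i) (MvPolynomial.rename σ a) f z p := by
  induction z with
  | zero => simp
  | add x y hx hy => rw [map_add, map_add, add_apply, add_apply, map_add, hx, hy, smul_add]
  | tmul P c =>
    let ρ' := Equiv.Perm.decomposeFin.symm (0, ρ)
    have hs : Equiv.Perm.sign ρ' = Equiv.Perm.sign ρ := by
      simp [ρ', Equiv.Perm.decomposeFin.symm_sign]
    have h0 : ρ' 0 = 0 := by simp [ρ']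
    have h1 : ∀ k, ρ' (Fin.succ k) = (ρ k).succ := by simp [ρ']
    have hc : (Fin.cons c (p ∘ ρ) : Fin (m + 1) → L) = (Fin.cons c p : Fin (m + 1) → L) ∘ ρ' := by
      ext k
      refine Fin.cases ?_ (fun k => ?_) k <;> simp [h0, h1]
    have he : (MvPolynomial.rename σ).comp (mergeVars j i) =
        (mergeVars (σ j) (τ i)).comp (MvPolynomial.rename ρ') := by
      ext1 k
      refine Fin.cases ?_ (fun k => ?_) k <;> simp [mergeVars, h0, h1, hτ, hρ]
    have key : ∀ v : Values L (m + 1),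
        Values.perm σ (Values.subst (mergeVars j i) (mergeVars_sum j i) v) =
          Values.subst (mergeVars (σ j) (τ i)) (mergeVars_sum _ _) (Values.perm ρ' v) := fun v => by
      obtain ⟨u, rfl⟩ := Values.mk_surjective _ v
      rw [Values.perm, Values.perm, Values.subst_mk, Values.subst_mk, Values.subst_mk,
        Values.subst_mk, mapCoeff_mapCoeff, mapCoeff_mapCoeff, he]
    have ha : MvPolynomial.rename σ (Polynomial.aeval a P) =
        Polynomial.aeval (MvPolynomial.rename σ a) P := by
      rw [Polynomial.aeval_algHom_apply]
    rw [insertFirst_tmul, insertFirst_tmul, Values.perm, Values.subst_smul, ← Values.perm, key,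
      hc, hf.2, map_zsmul, hs, ha, smul_comm]

theorem insertFirst_smul_of_update {m : ℕ} (j : Fin (m + 2)) (i : Fin (m + 1))
    (a : MvPolynomial (Fin (m + 2)) ℂ)
    {f : MultilinearMap ℂ (fun _ : Fin (m + 1) => L) (Values L (m + 1))}
    (hf : f ∈ Cochain L (m + 1)) (z : ℂ[X] ⊗[ℂ] L) (p : Fin m → L) (k : Fin m) :
    insertFirst j i a f z (Function.update p k (del L (p k))) =
      -((MvPolynomial.X (j.succAbove (i.succAbove k)) : MvPolynomial (Fin (m + 2)) ℂ) •
        insertFirst j i a f z p) := by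
  induction z with
  | zero => simp
  | add x y hx hy => rw [map_add, add_apply, add_apply, hx, hy, smul_add, neg_add]
  | tmul P c =>
    have h := hf.1 (Fin.cons c p) k.succ
    rw [← Fin.cons_update, Fin.cons_succ] at h
    rw [insertFirst_tmul, insertFirst_tmul, h, map_neg, smul_neg, Values.subst_smul, smul_comm]
    simp [mergeVars]

theorem SesquilinearBracket.bracketTerm_del (B : SesquilinearBracket L) {m : ℕ}
    (j : Fin (m + 2)) (i : Fin (m + 1))
    {f : MultilinearMap ℂ (fun _ : Fin (m + 1) => L) (Values L (m + 1))}
    (hf : f ∈ Cochain L (m + 1)) (p : Fin (m + 2) → L) (k : Fin (m + 2)) :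
    B.bracketTerm j i f (Function.update p k (del L (p k))) =
      -((MvPolynomial.X k : MvPolynomial (Fin (m + 2)) ℂ) • B.bracketTerm j i f p) := by
  rw [B.bracketTerm_apply, B.bracketTerm_apply]
  rcases eq_or_ne k j with rfl | hkj
  · simp only [Function.update_self, Fin.succAbove_ne, ne_eq, not_false_eq_true,
      Function.update_of_ne]
    rw [B.del_right, map_add, add_apply, insertFirst_X_smul, insertFirst_del _ _ _ hf, add_smul]
    abel
  · obtain ⟨l, rfl⟩ := Fin.exists_succAbove_eq hkj
    rw [Function.update_of_ne (Fin.succAbove_ne j l).symm]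
    rcases eq_or_ne l i with rfl | hli
    · have h : (fun q => Function.update p (j.succAbove l) (del L (p (j.succAbove l)))
          (j.succAbove (l.succAbove q))) = fun q => p (j.succAbove (l.succAbove q)) := by
        ext q; simp
      rw [h, Function.update_self, B.del_left, map_neg, neg_apply, insertFirst_X_smul]
    · obtain ⟨q, rfl⟩ := Fin.exists_succAbove_eq hli
      have h : (fun r => Function.update p (j.succAbove (i.succAbove q))
          (del L (p (j.succAbove (i.succAbove q)))) (j.succAbove (i.succAbove r))) =
          Function.update (fun r => p (j.succAbove (i.succAbove r))) q
            (del L (p (j.succAbove (i.succAbove q)))) := by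
        ext r; simp [Function.update_apply]
      rw [h, Function.update_of_ne (by simp),
        insertFirst_smul_of_update j i _ hf _ (fun r => p (j.succAbove (i.succAbove r))) q]

/-- Twice the sum over `i < j` is the sum over all pairs of distinct indices. -/
theorem LieConformalAlgebra.two_bracketSum (A : LieConformalAlgebra L) {m : ℕ}
    {f : MultilinearMap ℂ (fun _ : Fin (m + 1) => L) (Values L (m + 1))}
    (hf : f ∈ Cochain L (m + 1)) :
    (2 : ℂ) • A.bracketSum f = ∑ j : Fin (m + 2), ∑ i : Fin (m + 1),
      ((-1 : ℤ) ^ ((i : ℕ) + (j : ℕ))) • A.bracketTerm j i f := by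
  have hsplit : ∀ j : Fin (m + 2), ∑ i : Fin (m + 1),
      ((-1 : ℤ) ^ ((i : ℕ) + (j : ℕ))) • A.bracketTerm j i f =
      (∑ i : Fin (m + 1) with i.castSucc < j,
        ((-1 : ℤ) ^ ((i : ℕ) + (j : ℕ))) • A.bracketTerm j i f) +
      ∑ i : Fin (m + 1) with ¬ i.castSucc < j,
        ((-1 : ℤ) ^ ((i : ℕ) + (j : ℕ))) • A.bracketTerm j i f := fun j =>
    (Finset.sum_filter_add_sum_filter_not _ _ _).symm
  simp only [hsplit]
  rw [Finset.sum_add_distrib, two_smul, SesquilinearBracket.bracketSum]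
  congr 1
  rw [Finset.sum_sigma', Finset.sum_sigma']
  have inv : ∀ (j : Fin (m + 2)) (i : Fin (m + 1)),
      (i.predAbove j).predAbove (j.succAbove i) = i := fun j i => by
    simp [Fin.predAbove_predAbove_succAbove]
  refine Finset.sum_nbij' (fun x => ⟨x.1.succAbove x.2, x.2.predAbove x.1⟩)
    (fun x => ⟨x.1.succAbove x.2, x.2.predAbove x.1⟩) ?_ ?_ ?_ ?_ ?_
  · rintro ⟨j, i⟩ h
    simp only [Finset.mem_sigma, Finset.mem_univ, Finset.mem_filter, true_and] at h ⊢
    rw [Fin.succAbove_of_castSucc_lt _ _ h, Fin.predAbove_of_castSucc_lt _ _ h]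
    simp only [Fin.lt_def, Fin.val_castSucc, Fin.val_pred] at h ⊢
    omega
  · rintro ⟨j, i⟩ h
    simp only [Finset.mem_sigma, Finset.mem_univ, Finset.mem_filter, true_and, not_lt] at h ⊢
    rw [Fin.succAbove_of_le_castSucc _ _ h, Fin.predAbove_of_le_castSucc _ _ h]
    simp only [Fin.lt_def, Fin.le_def, Fin.val_castSucc, Fin.coe_castPred, Fin.val_succ] at h ⊢
    omega
  · rintro ⟨j, i⟩ h
    simp only [Fin.succAbove_succAbove_predAbove, inv]
  · rintro ⟨j, i⟩ h
    simp only [Fin.succAbove_succAbove_predAbove, inv]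
  · rintro ⟨j, i⟩ h
    ext p
    rw [smul_apply, smul_apply, A.bracketTerm_swap j i hf, smul_neg, ← neg_smul,
      add_comm (Fin.val _) (Fin.val (j.succAbove i)), Fin.neg_one_pow_succAbove_add_predAbove]
    simp [add_comm]

theorem LieConformalAlgebra.bracketSum_mem (A : LieConformalAlgebra L) {n : ℕ}
    {f : MultilinearMap ℂ (fun _ : Fin n => L) (Values L n)} (hf : f ∈ Cochain L n) :
    A.bracketSum f ∈ Cochain L (n + 1) := by
  cases n with
  | zero => exact zero_mem _
  | succ m =>
    suffices h : (2 : ℂ) • A.bracketSum f ∈ Cochain L (m + 2) by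
      have := (Cochain L (m + 2)).smul_mem (2 : ℂ)⁻¹ h
      rwa [smul_smul, inv_mul_cancel₀ two_ne_zero, one_smul] at this
    rw [A.two_bracketSum hf]
    have happ : ∀ p, (∑ j : Fin (m + 2), ∑ i : Fin (m + 1),
        ((-1 : ℤ) ^ ((i : ℕ) + (j : ℕ))) • A.bracketTerm j i f) p =
        ∑ j : Fin (m + 2), ∑ i : Fin (m + 1),
          ((-1 : ℤ) ^ ((i : ℕ) + (j : ℕ))) • A.bracketTerm j i f p := fun p => by simp
    refine ⟨fun p k => ?_, fun σ p => ?_⟩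
    · rw [happ, happ]
      simp only [Finset.smul_sum, ← Finset.sum_neg_distrib]
      refine Finset.sum_congr rfl fun j _ => Finset.sum_congr rfl fun i _ => ?_
      rw [A.bracketTerm_del j i hf, smul_neg, smul_comm]
    · rw [happ, happ, map_sum, Finset.smul_sum,
        ← Equiv.sum_comp σ (fun j => (Equiv.Perm.sign σ : ℤ) • ∑ i : Fin (m + 1),
          ((-1 : ℤ) ^ ((i : ℕ) + (j : ℕ))) • A.bracketTerm j i f p)]
      refine Finset.sum_congr rfl fun j _ => ?_
      obtain ⟨τ, hτ, hτs⟩ := exists_perm_succAbove σ j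
      rw [map_sum, Finset.smul_sum,
        ← Equiv.sum_comp τ (fun i => (Equiv.Perm.sign σ : ℤ) •
          ((-1 : ℤ) ^ ((i : ℕ) + (σ j : ℕ))) • A.bracketTerm (σ j) i f p)]
      refine Finset.sum_congr rfl fun i _ => ?_
      obtain ⟨ρ, hρ, hρs⟩ := exists_perm_succAbove τ i
      rw [A.bracketTerm_apply, A.bracketTerm_apply, map_zsmul]
      have e : (fun k => (p ∘ σ) (j.succAbove (i.succAbove k))) =
          (fun k => p ((σ j).succAbove ((τ i).succAbove k))) ∘ ρ := by
        ext k; simp [hτ, hρ]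
      rw [e, insertFirst_perm σ j i τ ρ hτ hρ hf, MvPolynomial.rename_X, hτ, Function.comp_apply,
        Function.comp_apply, hτ, smul_smul, smul_smul, hρs, hτs]
      congr 1
      have h1 : ((-1 : ℤ) ^ (i : ℕ)) * (-1) ^ (i : ℕ) = 1 := by rw [← mul_pow]; simp
      have h2 : ((-1 : ℤ) ^ (j : ℕ)) * (-1) ^ (j : ℕ) = 1 := by rw [← mul_pow]; simp
      rw [pow_add, pow_add]
      linear_combination ((Equiv.Perm.sign σ : ℤ) * (-1) ^ (σ j : ℕ) * (-1) ^ (τ i : ℕ)) *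
        ((-1 : ℤ) ^ (j : ℕ) * (-1) ^ (j : ℕ) * h1 + h2)

end Differentials

section Reduced
variable {L : Type*} [AddCommGroup L] [Module ℂ L] [Module ℂ[X] L] [IsScalarTower ℂ ℂ[X] L]

/-- The map `L[λ_1, …, λ_n] → Values L (n + 1)`; it is bijective. -/
noncomputable def Values.ofReduced (n : ℕ) : LPoly L n →ₗ[ℂ] Values L (n + 1) :=
  (Values.mk (n + 1)).restrictScalars ℂ ∘ₗ mapCoeff (MvPolynomial.rename Fin.castSucc)

theorem Values.ofReduced_apply (n : ℕ) (u : LPoly L n) : Values.ofReduced n u =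
    Values.mk (n + 1) (mapCoeff (MvPolynomial.rename Fin.castSucc) u) := rfl

theorem Values.ofReduced_surjective (n : ℕ) :
    Function.Surjective (Values.ofReduced (L := L) n) := by
  have hX : ∀ (k : Fin (n + 1)) (u : LPoly L n), ∃ w, Values.ofReduced n w =
      (MvPolynomial.X k : MvPolynomial (Fin (n + 1)) ℂ) • Values.ofReduced n u := by
    intro k u
    refine Fin.lastCases ?_ (fun k => ?_) k
    · refine ⟨-total L n u, ?_⟩
      have h := Values.mk_total (n + 1) (mapCoeff (MvPolynomial.rename Fin.castSucc) u)
      rw [total_apply, Fin.sum_univ_castSucc, add_smul, ← add_assoc] at h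
      rw [map_neg, Values.ofReduced_apply, Values.ofReduced_apply, ← _root_.map_smul, neg_eq_iff_add_eq_zero,
        ← map_add, ← h, total_apply, (mapCoeff (MvPolynomial.rename Fin.castSucc)).map_add,
        mapCoeff_baseChange, mapCoeff_smul, map_sum]
      simp only [MvPolynomial.rename_X]
    · refine ⟨(MvPolynomial.X k : MvPolynomial (Fin n) ℂ) • u, ?_⟩
      rw [Values.ofReduced_apply, Values.ofReduced_apply, ← _root_.map_smul, mapCoeff_smul,
        MvPolynomial.rename_X]
  intro v
  obtain ⟨u, rfl⟩ := Values.mk_surjective _ v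
  induction u using TensorProduct.induction_on with
  | zero => exact ⟨0, by simp⟩
  | add x y hx hy =>
    obtain ⟨a, ha⟩ := hx
    obtain ⟨b, hb⟩ := hy
    exact ⟨a + b, by rw [map_add, map_add, ha, hb]⟩
  | tmul P c =>
    induction P using MvPolynomial.induction_on with
    | C r => exact ⟨MvPolynomial.C r ⊗ₜ c, by simp [Values.ofReduced_apply]⟩
    | add P Q hP hQ =>
      obtain ⟨a, ha⟩ := hP
      obtain ⟨b, hb⟩ := hQ
      exact ⟨a + b, by rw [TensorProduct.add_tmul, map_add, map_add, ha, hb]⟩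
    | mul_X P k hP =>
      obtain ⟨a, ha⟩ := hP
      obtain ⟨w, hw⟩ := hX k a
      refine ⟨w, ?_⟩
      rw [hw, ha, ← _root_.map_smul, TensorProduct.smul_tmul', smul_eq_mul, mul_comm]

theorem Values.ofReduced_injective (n : ℕ) :
    Function.Injective (Values.ofReduced (L := L) n) := by
  let T : Module.End (MvPolynomial (Fin n) ℂ) (LPoly L n) := -total L n
  let φ : MvPolynomial (Fin (n + 1)) ℂ →ₐ[ℂ] Polynomial (MvPolynomial (Fin n) ℂ) :=
    (MvPolynomial.finSuccEquiv ℂ n).toAlgHom.comp (MvPolynomial.rename (finRotate (n + 1)))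
  have φc : ∀ k : Fin n, φ (MvPolynomial.X k.castSucc) = Polynomial.C (MvPolynomial.X k) := by
    intro k
    simp [φ, MvPolynomial.finSuccEquiv_X_succ]
  have φl : φ (MvPolynomial.X (Fin.last n)) = Polynomial.X := by
    simp [φ, MvPolynomial.finSuccEquiv_X_zero]
  have φr : ∀ Q, φ (MvPolynomial.rename Fin.castSucc Q) = Polynomial.C Q := by
    intro Q
    induction Q using MvPolynomial.induction_on with
    | C r => simp [φ]
    | add P Q hP hQ => simp [hP, hQ]
    | mul_X P k hP => simp [hP, φc]
  let elim : LPoly L (n + 1) →ₗ[ℂ] LPoly L n := TensorProduct.lift (LinearMap.mk₂ ℂ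
    (fun P c => Polynomial.aeval T (φ P) ((1 : MvPolynomial (Fin n) ℂ) ⊗ₜ[ℂ] c))
    (by simp) (by intro r P c; rw [_root_.map_smul, ← algebraMap_smul (MvPolynomial (Fin n) ℂ) r (φ P), _root_.map_smul,
        LinearMap.smul_apply, algebraMap_smul])
    (by simp [TensorProduct.tmul_add]) (by
      intro r P c; rw [TensorProduct.tmul_smul, LinearMap.map_smul_of_tower]))
  have helim : ∀ P c, elim (P ⊗ₜ c) =
      Polynomial.aeval T (φ P) ((1 : MvPolynomial (Fin n) ℂ) ⊗ₜ[ℂ] c) := fun _ _ => rfl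
  have h0 : ∀ u, elim (total L (n + 1) u) = 0 := by
    intro u
    induction u using TensorProduct.induction_on with
    | zero => simp
    | add x y hx hy => rw [map_add, map_add, hx, hy, add_zero]
    | tmul P c =>
      rw [total_apply, LinearMap.baseChange_tmul, TensorProduct.smul_tmul', map_add, helim, helim,
        smul_eq_mul, mul_comm, map_mul, Fin.sum_univ_castSucc, map_add φ, map_sum φ, φl, map_mul,
        Module.End.mul_apply, ← map_add]
      simp only [φc]
      rw [map_add (Polynomial.aeval T), map_sum]
      simp only [Polynomial.aeval_C, Polynomial.aeval_X]
      convert LinearMap.map_zero _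
      simp only [T, LinearMap.add_apply, LinearMap.neg_apply, total_apply, LinearMap.sum_apply,
        Module.algebraMap_end_apply, LinearMap.baseChange_tmul, Finset.sum_smul]
      abel
  have h1 : ∀ u, elim (mapCoeff (MvPolynomial.rename Fin.castSucc) u) = u := by
    intro u
    induction u using TensorProduct.induction_on with
    | zero => simp
    | add x y hx hy => rw [map_add, map_add, hx, hy]
    | tmul P c =>
      rw [mapCoeff_tmul, helim, φr, Polynomial.aeval_C, Module.algebraMap_end_apply,
        TensorProduct.smul_tmul', smul_eq_mul, mul_one]
  intro u v h
  have h' := congrArg (Values.lift elim h0) h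
  rwa [Values.ofReduced_apply, Values.ofReduced_apply, Values.lift_mk, Values.lift_mk, h1, h1] at h'

end Reduced

section Cohomology
variable {V : ℕ → Type*} [∀ n, AddCommGroup (V n)] [∀ n, Module ℂ (V n)]

/-- The coboundaries in degree `n`: the image of the incoming map (zero in degree `0`). -/
def coboundaries (D : ∀ n, V n →ₗ[ℂ] V (n + 1)) : ∀ n, Submodule ℂ (V n)
  | 0 => ⊥
  | n + 1 => LinearMap.range (D n)

/-- The cohomology in degree `n` of a sequence of maps `D n : V n → V (n + 1)`: cocycles modulo
those cocycles that are coboundaries. For a cochain complex all coboundaries are cocycles. -/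
def Cohomology (D : ∀ n, V n →ₗ[ℂ] V (n + 1)) (n : ℕ) : Type _ :=
  LinearMap.ker (D n) ⧸ (coboundaries D n).comap (LinearMap.ker (D n)).subtype

instance (D : ∀ n, V n →ₗ[ℂ] V (n + 1)) (n : ℕ) : AddCommGroup (Cohomology D n) :=
  inferInstanceAs
    (AddCommGroup (LinearMap.ker (D n) ⧸ (coboundaries D n).comap (LinearMap.ker (D n)).subtype))

noncomputable instance (D : ∀ n, V n →ₗ[ℂ] V (n + 1)) (n : ℕ) : Module ℂ (Cohomology D n) :=
  inferInstanceAs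
    (Module ℂ (LinearMap.ker (D n) ⧸ (coboundaries D n).comap (LinearMap.ker (D n)).subtype))

/-- The class of a cocycle. -/
def Cohomology.mk (D : ∀ n, V n →ₗ[ℂ] V (n + 1)) (n : ℕ) (f : V n) (hf : D n f = 0) :
    Cohomology D n :=
  Submodule.Quotient.mk (p := (coboundaries D n).comap (LinearMap.ker (D n)).subtype) ⟨f, hf⟩

end Cohomology

section Complexes
variable {L : Type*} [AddCommGroup L] [Module ℂ L] [Module ℂ[X] L] [IsScalarTower ℂ ℂ[X] L]

theorem SesquilinearBracket.actTerm_add (B : SesquilinearBracket L) {n : ℕ} (i : Fin (n + 1))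
    (f g : MultilinearMap ℂ (fun _ : Fin n => L) (Values L n)) :
    B.actTerm i (f + g) = B.actTerm i f + B.actTerm i g := by
  ext p; simp [actTerm_apply]

theorem SesquilinearBracket.actTerm_smul (B : SesquilinearBracket L) {n : ℕ} (i : Fin (n + 1))
    (c : ℂ) (f : MultilinearMap ℂ (fun _ : Fin n => L) (Values L n)) :
    B.actTerm i (c • f) = c • B.actTerm i f := by
  ext p; simp [actTerm_apply]

theorem insertFirst_add {m : ℕ} (j : Fin (m + 2)) (i : Fin (m + 1))
    (a : MvPolynomial (Fin (m + 2)) ℂ)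
    (f g : MultilinearMap ℂ (fun _ : Fin (m + 1) => L) (Values L (m + 1))) :
    insertFirst j i a (f + g) = insertFirst j i a f + insertFirst j i a g := by
  ext P c p
  simp [insertFirst_tmul]

theorem insertFirst_smul {m : ℕ} (j : Fin (m + 2)) (i : Fin (m + 1))
    (a : MvPolynomial (Fin (m + 2)) ℂ) (r : ℂ)
    (f : MultilinearMap ℂ (fun _ : Fin (m + 1) => L) (Values L (m + 1))) :
    insertFirst j i a (r • f) = r • insertFirst j i a f := by
  refine TensorProduct.ext' fun P c => ?_
  ext p
  rw [LinearMap.smul_apply, smul_apply, insertFirst_tmul, insertFirst_tmul, smul_apply, _root_.map_smul,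
    smul_comm]

theorem SesquilinearBracket.bracketSum_add (B : SesquilinearBracket L) {n : ℕ}
    (f g : MultilinearMap ℂ (fun _ : Fin n => L) (Values L n)) :
    B.bracketSum (f + g) = B.bracketSum f + B.bracketSum g := by
  cases n with
  | zero => simp [bracketSum]
  | succ m =>
    simp only [bracketSum, ← Finset.sum_add_distrib, ← smul_add]
    congr! 4
    ext p
    simp [bracketTerm_apply, insertFirst_add]

theorem SesquilinearBracket.bracketSum_smul (B : SesquilinearBracket L) {n : ℕ} (c : ℂ)
    (f : MultilinearMap ℂ (fun _ : Fin n => L) (Values L n)) :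
    B.bracketSum (c • f) = c • B.bracketSum f := by
  cases n with
  | zero => simp [bracketSum]
  | succ m =>
    simp only [bracketSum, Finset.smul_sum, smul_comm c]
    congr! 4
    ext p
    simp [bracketTerm_apply, insertFirst_smul]

/-- `actSum` as a map of cochains. -/
noncomputable def SesquilinearBracket.actMap (B : SesquilinearBracket L) (n : ℕ) :
    Cochain L n →ₗ[ℂ] Cochain L (n + 1) where
  toFun f := ⟨B.actSum f.1, B.actSum_mem f.2⟩
  map_add' f g := Subtype.ext (by
    simp [SesquilinearBracket.actSum, B.actTerm_add, Finset.sum_add_distrib])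
  map_smul' c f := Subtype.ext (by
    simp [SesquilinearBracket.actSum, B.actTerm_smul, Finset.smul_sum, smul_comm c])

/-- `bracketSum` as a map of cochains. -/
noncomputable def LieConformalAlgebra.bracketMap (A : LieConformalAlgebra L) (n : ℕ) :
    Cochain L n →ₗ[ℂ] Cochain L (n + 1) where
  toFun f := ⟨A.bracketSum f.1, A.bracketSum_mem f.2⟩
  map_add' f g := Subtype.ext (A.bracketSum_add f.1 g.1)
  map_smul' c f := Subtype.ext (A.bracketSum_smul c f.1)

/-- The map `f ↦ N ∘ f` on cochains. -/
noncomputable def postcomp (N : L →ₗ[ℂ[X]] L) (n : ℕ) : Cochain L n →ₗ[ℂ] Cochain L n where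
  toFun f := ⟨(Values.map N n).compMultilinearMap f.1, by
    refine ⟨fun p k => ?_, fun σ p => ?_⟩
    · rw [LinearMap.compMultilinearMap_apply, LinearMap.compMultilinearMap_apply, f.2.1, map_neg,
        Values.map_smul]
    · rw [LinearMap.compMultilinearMap_apply, LinearMap.compMultilinearMap_apply,
        ← Values.map_perm, f.2.2, map_zsmul]⟩
  map_add' f g := by ext p; simp
  map_smul' c f := by ext p; simp

/-- The coboundary operator `δ` of a Lie conformal algebra with coefficients in the adjoint
representation. -/
noncomputable def LieConformalAlgebra.coboundary (A : LieConformalAlgebra L) (n : ℕ) :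
    Cochain L n →ₗ[ℂ] Cochain L (n + 1) :=
  A.actMap n + A.bracketMap n

/-- The differential `d_N` of a Nijenhuis operator: for an `n`-cochain `f`,
`∑ (-1)^i [N(p_i)_{λ_i} f(…)] + ∑_{i<j} (-1)^{i+j} f_{λ_i + λ_j, …}([(p_i)_{λ_i} p_j]_N, …) - N(δ f)`. -/
noncomputable def LieConformalAlgebra.nijenhuisDifferential (A : LieConformalAlgebra L)
    (N : L →ₗ[ℂ[X]] L) (hN : A.IsNijenhuis N) (n : ℕ) :
    Cochain L n →ₗ[ℂ] Cochain L (n + 1) :=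
  (A.compLeft N).actMap n + (A.deformed N hN).bracketMap n - postcomp N (n + 1) ∘ₗ A.coboundary n

/-- The map `Φ^n(f) = (-1)^{n+1} δ f`, where `δ` is the coboundary operator of the original bracket. -/
noncomputable def LieConformalAlgebra.Phi (A : LieConformalAlgebra L) (n : ℕ) :
    Cochain L n →ₗ[ℂ] Cochain L (n + 1) :=
  ((-1 : ℤ) ^ (n + 1)) • A.coboundary n

end Complexes

end LieConformal

/-
Write `D` for the coboundary of the given bracket, `P f = N ∘ f` and `S f = ∑_k f(…, N p_k, …)`.
Termwise, `[N(p_i) f(…)]` and `f([p_i, p_j]_N, …)` are what is left of `S D - D S` after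
cancellation, so `d_N = S D - D S - P D` and `δ_N = S D - D S + D P - P D` for every
`ℂ[∂]`-linear `N`. Since `D² = 0`, both `δ_N D` and `-D d_N` equal `D P D - D S D`, and the
alternating signs in `Φ` turn `δ_N D = -D d_N` into `δ_N Φ = Φ d_N`.

For `D² = 0`, evaluate the variables `λ_i` at elements `a_i` of an arbitrary commutative algebra:
`[p_λ q]` becomes a bracket of elements `p e^{a x}`, cochains become skew functions of such elements
with values in exponential sums modulo total derivatives, and `λ_n = -∂ - λ_1 - ⋯` holds because a
derivative is zero there. Taking the `a_i` to be independent variables loses nothing. What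
remains is `d² = 0` for the Chevalley-Eilenberg differential, which follows from Cartan's formula.
-/

namespace LieConformal

section Leibniz
variable {X T : Type*} {n : ℕ}

/-- Insertion of `x` as the first argument of `F`. -/
def contract (x : X) (F : (Fin (n + 1) → X) → T) : (Fin n → X) → T :=
  fun p => F (Fin.cons x p)

theorem eq_of_contract_eq {F G : (Fin (n + 1) → X) → T} (h : ∀ x, contract x F = contract x G) :
    F = G :=
  funext fun p => by simpa [contract] using congrFun (h (p 0)) (Fin.tail p)

variable [AddCommGroup T] (br : X → X → X) (act : X → T →+ T)

/-- `F` takes the Jacobi identity `[x, [y, z]] = [[x, y], z] + [y, [x, z]]`, put into any of its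
arguments, to an identity in `T`. There is no addition on `X`, so that `X` may consist of the
homogeneous elements of a graded algebra. -/
def RespectsJacobi (F : (Fin n → X) → T) : Prop :=
  ∀ (p : Fin n → X) (k : Fin n) (x y z : X), F (Function.update p k (br x (br y z))) =
    F (Function.update p k (br (br x y) z)) + F (Function.update p k (br y (br x z)))

/-- `act` is a representation on `T` of the left Leibniz bracket `br`:
`x ⬝ (y ⬝ t) = [x, y] ⬝ t + y ⬝ (x ⬝ t)`. -/
def IsLeibnizAction : Prop :=
  ∀ x y t, act x (act y t) = act (br x y) t + act y (act x t)

/-- The Lie derivative along `x` of a `T`-valued function of `n` arguments. -/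
def lieDer (x : X) (F : (Fin n → X) → T) : (Fin n → X) → T :=
  fun p => act x (F p) - ∑ k, F (Function.update p k (br x (p k)))

/-- The coboundary operator of a left Leibniz bracket, defined recursively by Cartan's formula
`ι_x ∘ d + d ∘ ι_x = lieDer x`. -/
def leibnizD : {n : ℕ} → ((Fin n → X) → T) → (Fin (n + 1) → X) → T
  | 0, F => fun p => lieDer br act (p 0) F (Fin.tail p)
  | _ + 1, F => fun p =>
      lieDer br act (p 0) F (Fin.tail p) - leibnizD (contract (p 0) F) (Fin.tail p)

theorem contract_sub (x : X) (F G : (Fin (n + 1) → X) → T) :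
    contract x (F - G) = contract x F - contract x G := rfl

theorem contract_add (x : X) (F G : (Fin (n + 1) → X) → T) :
    contract x (F + G) = contract x F + contract x G := rfl

theorem lieDer_sub (x : X) (F G : (Fin n → X) → T) :
    lieDer br act x (F - G) = lieDer br act x F - lieDer br act x G := by
  funext p
  simp only [lieDer, Pi.sub_apply, map_sub, Finset.sum_sub_distrib]
  abel

theorem contract_lieDer (x y : X) (F : (Fin (n + 1) → X) → T) :
    contract y (lieDer br act x F) = lieDer br act x (contract y F) - contract (br x y) F := by
  funext p
  simp only [contract, lieDer, Pi.sub_apply, Fin.sum_univ_succ, Fin.cons_zero, Fin.cons_succ,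
    Fin.update_cons_zero, Fin.cons_update]
  abel

theorem contract_leibnizD_zero (x : X) (F : (Fin 0 → X) → T) :
    contract x (leibnizD br act F) = lieDer br act x F := rfl

theorem contract_leibnizD (x : X) (F : (Fin (n + 1) → X) → T) :
    contract x (leibnizD br act F) =
      lieDer br act x F - leibnizD br act (contract x F) := rfl

theorem leibnizD_sub (F G : (Fin n → X) → T) :
    leibnizD br act (F - G) = leibnizD br act F - leibnizD br act G := by
  induction n with
  | zero =>
    refine eq_of_contract_eq fun x => ?_
    simp only [contract_sub, contract_leibnizD_zero, lieDer_sub]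
  | succ n ih =>
    refine eq_of_contract_eq fun x => ?_
    simp only [contract_sub, contract_leibnizD, lieDer_sub, ih]
    abel

variable {br act}

theorem RespectsJacobi.contract {F : (Fin (n + 1) → X) → T} (hF : RespectsJacobi br F) (w : X) :
    RespectsJacobi br (contract w F) := fun p k x y z => by
  simpa only [LieConformal.contract, Fin.cons_update] using hF (Fin.cons w p) k.succ x y z

theorem RespectsJacobi.contract_br {F : (Fin (n + 1) → X) → T} (hF : RespectsJacobi br F)
    (x y z : X) :
    LieConformal.contract (br x (br y z)) F =
      LieConformal.contract (br (br x y) z) F + LieConformal.contract (br y (br x z)) F := by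
  funext p
  simpa only [Pi.add_apply, LieConformal.contract, Fin.update_cons_zero] using
    hF (Fin.cons x p) 0 x y z

theorem lieDer_lieDer (hact : IsLeibnizAction br act) (x y : X) {F : (Fin n → X) → T}
    (hF : RespectsJacobi br F) :
    lieDer br act x (lieDer br act y F) =
      lieDer br act (br x y) F + lieDer br act y (lieDer br act x F) := by
  induction n with
  | zero => funext p; simp [lieDer, hact x y]
  | succ n ih =>
    refine eq_of_contract_eq fun z => ?_
    simp only [contract_add, contract_lieDer, lieDer_sub, ih (hF.contract z), hF.contract_br x y z]
    abel

theorem leibnizD_lieDer (hact : IsLeibnizAction br act) (x : X) {F : (Fin n → X) → T}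
    (hF : RespectsJacobi br F) :
    leibnizD br act (lieDer br act x F) = lieDer br act x (leibnizD br act F) := by
  induction n with
  | zero =>
    refine eq_of_contract_eq fun y => ?_
    simp only [contract_lieDer, contract_leibnizD_zero, lieDer_lieDer hact x y hF]
    abel
  | succ n ih =>
    refine eq_of_contract_eq fun y => ?_
    simp only [contract_lieDer, contract_leibnizD, lieDer_sub, leibnizD_sub, ih (hF.contract y),
      lieDer_lieDer hact x y hF]
    abel

theorem leibnizD_leibnizD (hact : IsLeibnizAction br act) {F : (Fin n → X) → T}
    (hF : RespectsJacobi br F) : leibnizD br act (leibnizD br act F) = 0 := by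
  induction n with
  | zero =>
    refine eq_of_contract_eq fun y => ?_
    rw [contract_leibnizD, contract_leibnizD_zero, leibnizD_lieDer hact y hF, sub_self]
    rfl
  | succ n ih =>
    refine eq_of_contract_eq fun y => ?_
    rw [contract_leibnizD, contract_leibnizD, leibnizD_sub, leibnizD_lieDer hact y hF,
      ih (hF.contract y), sub_zero, sub_self]
    rfl

end Leibniz

section ChevalleyEilenberg
variable {X T : Type*} [AddCommGroup T] {n : ℕ} (br : X → X → X) (act : X → T →+ T)

/-- The part `∑_{i<j} (-1)^{i+j} F([p_i, p_j], …)` of the Chevalley–Eilenberg coboundary, with `i`,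
`j` counted from `0`. Here `i` is read as `j.succAbove i`, which is `i` itself when `i < j`. -/
def bracketD : {n : ℕ} → ((Fin n → X) → T) → (Fin (n + 1) → X) → T
  | 0, _ => 0
  | m + 1, F => fun p => ∑ j : Fin (m + 2), ∑ i : Fin (m + 1) with i.castSucc < j,
      ((-1 : ℤ) ^ ((i : ℕ) + (j : ℕ))) •
        F (Fin.cons (br (p (j.succAbove i)) (p j)) (i.removeNth (j.removeNth p)))

/-- The Chevalley–Eilenberg formula for the coboundary operator. -/
def chevalleyD (F : (Fin n → X) → T) : (Fin (n + 1) → X) → T := fun p =>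
  ∑ i : Fin (n + 1), ((-1 : ℤ) ^ (i : ℕ)) • act (p i) (F (i.removeNth p)) + bracketD br F p

/-- `F` is skew-symmetric in its arguments. -/
def IsSkew (F : (Fin n → X) → T) : Prop :=
  ∀ (σ : Equiv.Perm (Fin n)) (p : Fin n → X), F (p ∘ σ) = (Equiv.Perm.sign σ : ℤ) • F p

theorem IsSkew.contract {F : (Fin (n + 1) → X) → T} (hF : IsSkew F) (x : X) :
    IsSkew (contract x F) := fun σ p => by
  let τ := Equiv.Perm.decomposeFin.symm (0, σ)
  have hsign : Equiv.Perm.sign τ = Equiv.Perm.sign σ := by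
    simp [τ, Equiv.Perm.decomposeFin.symm_sign]
  have hcons : (Fin.cons x (p ∘ σ) : Fin (n + 1) → X) = (Fin.cons x p : Fin (n + 1) → X) ∘ τ := by
    ext k
    cases k using Fin.cases <;> simp [τ]
  rw [LieConformal.contract, LieConformal.contract, hcons, hF, hsign]

theorem IsSkew.cons_removeNth {F : (Fin (n + 1) → X) → T} (hF : IsSkew F) (p : Fin (n + 1) → X)
    (k : Fin (n + 1)) (z : X) :
    F (Fin.cons z (k.removeNth p)) = ((-1 : ℤ) ^ (k : ℕ)) • F (Function.update p k z) := by
  rw [← Fin.insertNth_removeNth, ← Fin.insertNth_comp_cycleRange_symm k, hF]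
  simp [Fin.sign_cycleRange]

theorem removeNth_succ_cons {m : ℕ} (x : X) (q : Fin (m + 1) → X) (i : Fin (m + 1)) :
    i.succ.removeNth (Fin.cons x q : Fin (m + 2) → X) = Fin.cons x (i.removeNth q) :=
  Fin.cons_comp_succ_succAbove x q i

theorem IsSkew.cons_cons {F : (Fin (n + 2) → X) → T} (hF : IsSkew F) (q : Fin n → X) (x y : X) :
    F (Fin.cons x (Fin.cons y q)) = -F (Fin.cons y (Fin.cons x q)) := by
  have h := hF.cons_removeNth (Fin.cons y (Fin.cons x q)) (Fin.succ 0) x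
  rw [removeNth_succ_cons, ← Fin.cons_update, Fin.update_cons_zero, Fin.removeNth_zero,
    Fin.tail_cons] at h
  simpa using h

theorem sum_castSucc_lt_succ {m : ℕ} (G : Fin (m + 2) → Fin (m + 1) → T) :
    ∑ j : Fin (m + 2), ∑ i : Fin (m + 1) with i.castSucc < j, G j i =
      ∑ j : Fin (m + 1), G j.succ 0 +
        ∑ j : Fin (m + 1), ∑ i : Fin m with i.castSucc < j, G j.succ i.succ := by
  rw [Fin.sum_univ_succ, ← Finset.sum_add_distrib, Finset.sum_eq_zero (by simp), zero_add]
  refine Finset.sum_congr rfl fun j _ => ?_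
  rw [Finset.sum_filter, Fin.sum_univ_succ, Finset.sum_filter]
  simp only [Fin.castSucc_zero, Fin.succ_pos, if_true, ← Fin.succ_castSucc, Fin.succ_lt_succ_iff]

variable {br act}

theorem IsSkew.bracketD_cons {F : (Fin (n + 1) → X) → T} (hF : IsSkew F) (x : X)
    (q : Fin (n + 1) → X) :
    bracketD br F (Fin.cons x q) =
      -∑ k, F (Function.update q k (br x (q k))) - bracketD br (LieConformal.contract x F) q := by
  have bracket_with_x : ∑ j : Fin (n + 1), ((-1 : ℤ) ^ (((0 : Fin (n + 1)) : ℕ) + (j.succ : ℕ))) •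
      F (Fin.cons (br x (q j)) (j.removeNth q)) = -∑ k, F (Function.update q k (br x (q k))) := by
    rw [← Finset.sum_neg_distrib]
    refine Finset.sum_congr rfl fun j _ => ?_
    rw [hF.cons_removeNth, smul_smul, ← pow_add, Odd.neg_one_pow ⟨j, by simp; ring⟩, neg_one_smul]
  rw [bracketD]
  beta_reduce
  rw [sum_castSucc_lt_succ, sub_eq_add_neg, ← bracket_with_x]
  congr 1
  · simp [removeNth_succ_cons]
  · cases n with
    | zero => simp [bracketD]
    | succ m =>
      simp only [bracketD, ← Finset.sum_neg_distrib]
      refine Finset.sum_congr rfl fun j _ => Finset.sum_congr rfl fun i _ => ?_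
      rw [removeNth_succ_cons, removeNth_succ_cons, hF.cons_cons, Fin.succ_succAbove_succ,
        Fin.cons_succ, Fin.cons_succ, smul_neg, LieConformal.contract, Fin.val_succ, Fin.val_succ,
        add_add_add_comm, pow_add, neg_one_sq, mul_one]

theorem IsSkew.contract_chevalleyD {F : (Fin (n + 1) → X) → T} (hF : IsSkew F) (x : X) :
    LieConformal.contract x (chevalleyD br act F) =
      lieDer br act x F - chevalleyD br act (LieConformal.contract x F) := by
  funext q
  rw [LieConformal.contract, chevalleyD, hF.bracketD_cons, Fin.sum_univ_succ]
  simp only [Pi.sub_apply, lieDer, chevalleyD, removeNth_succ_cons, Fin.cons_zero, Fin.cons_succ,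
    Fin.removeNth_zero, Fin.tail_cons, Fin.val_zero, Fin.val_succ, pow_zero, one_smul, pow_succ,
    mul_neg, mul_one, neg_smul, Finset.sum_neg_distrib, LieConformal.contract]
  abel

theorem IsSkew.chevalleyD_eq {F : (Fin n → X) → T} (hF : IsSkew F) :
    chevalleyD br act F = leibnizD br act F := by
  induction n with
  | zero =>
    refine eq_of_contract_eq fun x => funext fun q => ?_
    simp [leibnizD, LieConformal.contract, chevalleyD, bracketD, lieDer]
  | succ n ih =>
    refine eq_of_contract_eq fun x => ?_
    rw [contract_leibnizD, hF.contract_chevalleyD, ih (hF.contract x)]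

end ChevalleyEilenberg

section MultilinearBaseChange
variable {k R M W : Type*} [CommSemiring k] [CommSemiring R] [Algebra k R] [AddCommMonoid M]
  [Module k M] [AddCommMonoid W] [Module R W]

theorem multilinear_baseChange_ext {n : ℕ}
    {g h : MultilinearMap R (fun _ : Fin n => R ⊗[k] M) W}
    (H : ∀ p : Fin n → M, g (fun i => 1 ⊗ₜ p i) = h (fun i => 1 ⊗ₜ p i)) : g = h := by
  have hspan : Submodule.span R (Set.range fun p : M => (1 : R) ⊗ₜ[k] p) = ⊤ := by
    rw [← Submodule.baseChange_top R, ← Submodule.span_univ, Submodule.baseChange_span,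
      Set.image_univ]
    rfl
  exact MultilinearMap.ext_of_span_eq_top (fun _ => hspan) H

variable [Module k W] [IsScalarTower k R W]

instance isScalarTower_multilinearMap {ι : Type*} (V : ι → Type*) [∀ i, AddCommMonoid (V i)]
    [∀ i, Module R (V i)] : IsScalarTower k R (MultilinearMap R V W) :=
  ⟨fun c r f => MultilinearMap.ext fun p => smul_assoc c r (f p)⟩

/-- The `R`-multilinear extension to `R ⊗ M` of a `k`-multilinear map on `M` with values in an
`R`-module. -/
noncomputable def liftMultilinear : (n : ℕ) →
    MultilinearMap k (fun _ : Fin n => M) W →ₗ[k] MultilinearMap R (fun _ : Fin n => R ⊗[k] M) W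
  | 0 => (MultilinearMap.constLinearEquivOfIsEmpty R k (fun _ => R ⊗[k] M) W).toLinearMap ∘ₗ
      (MultilinearMap.constLinearEquivOfIsEmpty k k (fun _ => M) W).symm.toLinearMap
  | n + 1 =>
    (multilinearCurryLeftEquiv R (fun _ => R ⊗[k] M) W).symm.toLinearMap.restrictScalars k ∘ₗ
      (LinearMap.liftBaseChangeEquiv R).toLinearMap.restrictScalars k ∘ₗ
      LinearMap.compRight k (liftMultilinear n) ∘ₗ
      (multilinearCurryLeftEquiv k (fun _ => M) W).toLinearMap

theorem liftMultilinear_one_tmul {n : ℕ} (f : MultilinearMap k (fun _ : Fin n => M) W)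
    (p : Fin n → M) : liftMultilinear (R := R) n f (fun i => 1 ⊗ₜ p i) = f p := by
  induction n with
  | zero => simp [liftMultilinear, Subsingleton.elim p 0]
  | succ n ih =>
    have htail : (Fin.tail fun i => (1 : R) ⊗ₜ[k] p i) = fun i => 1 ⊗ₜ Fin.tail p i := rfl
    simp [liftMultilinear, htail, ih]

end MultilinearBaseChange

section Jacobi
variable {R L : Type*} [CommRing R] [Algebra ℂ R] [AddCommGroup L] [Module ℂ L] [Module ℂ[X] L]
  [IsScalarTower ℂ ℂ[X] L]

theorem LieConformalAlgebra.extend_jacobi (A : LieConformalAlgebra L) (a b : R)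
    (u v w : R ⊗[ℂ] L) :
    extend A.bracket a u (extend A.bracket b v w) =
      extend A.bracket (a + b) (extend A.bracket a u v) w +
      extend A.bracket b v (extend A.bracket a u w) := by
  induction u with
  | zero => simp
  | add x y hx hy => simp only [map_add, LinearMap.add_apply, hx, hy]; abel
  | tmul r p =>
    induction v with
    | zero => simp
    | add x y hx hy => simp only [map_add, LinearMap.add_apply, hx, hy]; abel
    | tmul s q =>
      induction w with
      | zero => simp
      | add x y hx hy => simp only [map_add, hx, hy]; abel
      | tmul t w =>
        have jacobi_eval := congrArg (mapCoeff (MvPolynomial.aeval ![a, b])) (A.jacobi p q w)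
        simp only [map_add, mapCoeff_extend, mapCoeff_tmul, map_one, MvPolynomial.aeval_X,
          Matrix.cons_val_zero, Matrix.cons_val_one] at jacobi_eval
        rw [TensorProduct.tmul_eq_smul_one_tmul r, TensorProduct.tmul_eq_smul_one_tmul s,
          TensorProduct.tmul_eq_smul_one_tmul t]
        simp only [map_smul, LinearMap.smul_apply, jacobi_eval, smul_add, smul_smul]
        congr 2 <;> ring

end Jacobi

section ExpModule
variable {R M : Type*} [CommRing R] [AddCommGroup M] [Module R M] (D : M →ₗ[R] M)

/-- The derivative `D + d/dx` of formal exponential sums `∑ u_c e^{cx}`; such a sum is encoded as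
the finitely supported function `c ↦ u_c`. -/
noncomputable def expDeriv : (R →₀ M) →ₗ[R] (R →₀ M) :=
  Finsupp.lsum R fun c => Finsupp.lsingle c ∘ₗ (D + c • LinearMap.id)

/-- Formal exponential sums `∑ u_c e^{cx}` modulo derivatives. For `D = ∂` on `R ⊗ L`, the values
of cochains of every degree map to this one module when elements of `R` are substituted for the
variables `λ`. -/
def ExpModule : Type _ := (R →₀ M) ⧸ LinearMap.range (expDeriv D)

noncomputable instance : AddCommGroup (ExpModule D) :=
  inferInstanceAs (AddCommGroup ((R →₀ M) ⧸ LinearMap.range (expDeriv D)))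

noncomputable instance : Module R (ExpModule D) :=
  inferInstanceAs (Module R ((R →₀ M) ⧸ LinearMap.range (expDeriv D)))

theorem expDeriv_single (c : R) (u : M) :
    expDeriv D (Finsupp.single c u) = Finsupp.single c (D u + c • u) := by
  simp [expDeriv]

theorem expDeriv_apply (f : R →₀ M) (c : R) : expDeriv D f c = D (f c) + c • f c := by
  induction f using Finsupp.induction_linear with
  | zero => simp
  | add f g hf hg => simp only [map_add, Finsupp.add_apply, hf, hg, smul_add]; abel
  | single b u =>
    rw [expDeriv_single]
    rcases eq_or_ne b c with rfl | hbc
    · simp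
    · simp [hbc]

namespace ExpModule

noncomputable instance {k : Type*} [Semiring k] [SMul k R] [Module k M] [IsScalarTower k R M] :
    Module k (ExpModule D) :=
  inferInstanceAs (Module k ((R →₀ M) ⧸ LinearMap.range (expDeriv D)))

instance {k : Type*} [Semiring k] [SMul k R] [Module k M] [IsScalarTower k R M] :
    IsScalarTower k R (ExpModule D) :=
  inferInstanceAs (IsScalarTower k R ((R →₀ M) ⧸ LinearMap.range (expDeriv D)))

/-- The class of `u e^{cx}`. -/
noncomputable def single (c : R) : M →ₗ[R] ExpModule D :=
  (LinearMap.range (expDeriv D)).mkQ ∘ₗ Finsupp.lsingle c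

theorem single_deriv (c : R) (u : M) : single D c (D u + c • u) = 0 :=
  (Submodule.Quotient.mk_eq_zero _).2 ⟨Finsupp.single c u, expDeriv_single D c u⟩

variable {D}

theorem exists_of_single_eq_zero {c : R} {u : M} (h : single D c u = 0) :
    ∃ v, D v + c • v = u := by
  obtain ⟨f, hf⟩ := (Submodule.Quotient.mk_eq_zero _).1 h
  exact ⟨f c, by rw [← expDeriv_apply, hf, Finsupp.lsingle_apply, Finsupp.single_eq_same]⟩

variable {W : Type*} [AddCommGroup W] [Module R W]

/-- The map out of `ExpModule D` with prescribed values on each `u e^{cx}`. -/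
noncomputable def lift (φ : R → M →ₗ[R] W) (h : ∀ c u, φ c (D u + c • u) = 0) :
    ExpModule D →ₗ[R] W :=
  (LinearMap.range (expDeriv D)).liftQ (Finsupp.lsum R φ) <| by
    rw [LinearMap.range_le_ker_iff]
    refine Finsupp.lhom_ext fun c u => ?_
    rw [LinearMap.comp_apply, expDeriv_single, Finsupp.lsum_single, h, LinearMap.zero_apply]

theorem lift_single (φ : R → M →ₗ[R] W) (h : ∀ c u, φ c (D u + c • u) = 0) (c : R) (u : M) :
    lift φ h (single D c u) = φ c u :=
  Finsupp.lsum_single R φ c u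

theorem hom_ext {g h : ExpModule D →ₗ[R] W} (H : ∀ c u, g (single D c u) = h (single D c u)) :
    g = h :=
  Submodule.linearMap_qext _ <| Finsupp.lhom_ext fun c u => H c u

end ExpModule

end ExpModule

section ExpAction
variable {R L : Type*} [CommRing R] [Algebra ℂ R] [AddCommGroup L] [Module ℂ L] [Module ℂ[X] L]
  [IsScalarTower ℂ ℂ[X] L]

variable (R L) in
/-- Exponential sums with coefficients in `R ⊗ L`, modulo total derivatives `∂ + d/dx`. -/
abbrev ExpSums : Type _ := ExpModule ((del L).baseChange R)

/-- The action of `u e^{ax}` on exponential sums: `v e^{cx}` goes to `[u_a v] e^{(a+c)x}`. -/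
noncomputable def SesquilinearBracket.expAct (B : SesquilinearBracket L) (a : R) :
    R ⊗[ℂ] L →ₗ[R] ExpSums R L →ₗ[R] ExpSums R L where
  toFun u := ExpModule.lift (fun c => ExpModule.single _ (a + c) ∘ₗ extend B.bracket a u)
    fun c v => by
      rw [LinearMap.comp_apply, map_add, map_smul, B.extend_del_right,
        ← ExpModule.single_deriv _ (a + c) (extend B.bracket a u v), add_smul, add_assoc]
  map_add' u v := ExpModule.hom_ext fun c w => by simp [ExpModule.lift_single]
  map_smul' r u := ExpModule.hom_ext fun c w => by simp [ExpModule.lift_single]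

theorem SesquilinearBracket.expAct_single (B : SesquilinearBracket L) (a c : R)
    (u v : R ⊗[ℂ] L) :
    B.expAct a u (ExpModule.single _ c v) =
      ExpModule.single _ (a + c) (extend B.bracket a u v) := by
  simp [expAct, ExpModule.lift_single]

/-- The bracket `[u e^{ax}, v e^{bx}] = [u_a v] e^{(a+b)x}`, the pair `(a, u)` encoding
`u e^{ax}`. -/
noncomputable def SesquilinearBracket.expBr (B : SesquilinearBracket L)
    (x y : R × (R ⊗[ℂ] L)) : R × (R ⊗[ℂ] L) :=
  (x.1 + y.1, extend B.bracket x.1 x.2 y.2)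

/-- The action of `expAct`, with the pair `(a, u)` encoding `u e^{ax}`. -/
noncomputable def SesquilinearBracket.expActHom (B : SesquilinearBracket L)
    (x : R × (R ⊗[ℂ] L)) : ExpSums R L →+ ExpSums R L :=
  (B.expAct x.1 x.2).toAddMonoidHom

theorem LieConformalAlgebra.isLeibnizAction_expActHom (A : LieConformalAlgebra L) :
    IsLeibnizAction (X := R × (R ⊗[ℂ] L)) A.expBr A.expActHom :=
  fun x y => DFunLike.congr_fun <|
    show A.expAct x.1 x.2 ∘ₗ A.expAct y.1 y.2 =
        A.expAct (x.1 + y.1) (extend A.bracket x.1 x.2 y.2) +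
          A.expAct y.1 y.2 ∘ₗ A.expAct x.1 x.2 from
    ExpModule.hom_ext fun c u => by
      simp only [LinearMap.comp_apply, LinearMap.add_apply, SesquilinearBracket.expAct_single]
      rw [A.extend_jacobi, map_add, add_assoc, add_left_comm y.1 x.1 c]

end ExpAction

section ValuesEval
variable {R L : Type*} [CommRing R] [Algebra ℂ R] [AddCommGroup L] [Module ℂ L] [Module ℂ[X] L]
  [IsScalarTower ℂ ℂ[X] L]

/-- The substitution of `a` for the variables `λ` in a value of a cochain. As
`∂ + λ_1 + … + λ_n` vanishes on values, the result is placed at the exponent `∑ k, a k`. -/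
noncomputable def valuesEval {n : ℕ} (a : Fin n → R) : Values L n →ₗ[ℂ] ExpSums R L :=
  Values.lift
    ((ExpModule.single _ (∑ k, a k)).restrictScalars ℂ ∘ₗ mapCoeff (MvPolynomial.aeval a))
    fun u => by
      rw [total_apply, LinearMap.comp_apply, map_add, mapCoeff_baseChange, mapCoeff_smul,
        LinearMap.restrictScalars_apply, map_sum]
      simp only [MvPolynomial.aeval_X]
      exact ExpModule.single_deriv _ _ _

theorem valuesEval_mk {n : ℕ} (a : Fin n → R) (u : LPoly L n) :
    valuesEval a (Values.mk n u) =
      ExpModule.single _ (∑ k, a k) (mapCoeff (MvPolynomial.aeval a) u) := rfl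

theorem valuesEval_smul {n : ℕ} (a : Fin n → R) (P : MvPolynomial (Fin n) ℂ) (v : Values L n) :
    valuesEval a (P • v) = MvPolynomial.aeval a P • valuesEval a v := by
  obtain ⟨u, rfl⟩ := Values.mk_surjective n v
  rw [← map_smul, valuesEval_mk, valuesEval_mk, mapCoeff_smul, map_smul]

theorem valuesEval_subst {m n : ℕ} (a : Fin n → R)
    (e : MvPolynomial (Fin m) ℂ →ₐ[ℂ] MvPolynomial (Fin n) ℂ)
    (he : e (∑ k, MvPolynomial.X k) = ∑ k, MvPolynomial.X k) (v : Values L m) :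
    valuesEval a (Values.subst e he v) =
      valuesEval (fun k => MvPolynomial.aeval a (e (MvPolynomial.X k))) v := by
  obtain ⟨u, rfl⟩ := Values.mk_surjective m v
  have sum_eq : ∑ k, MvPolynomial.aeval a (e (MvPolynomial.X k)) = ∑ k, a k := by
    rw [← map_sum, ← map_sum, he]
    simp
  have comp_eq : (MvPolynomial.aeval a).comp e =
      MvPolynomial.aeval fun k => MvPolynomial.aeval a (e (MvPolynomial.X k)) := by
    ext k; simp
  rw [Values.subst_mk, valuesEval_mk, valuesEval_mk, mapCoeff_mapCoeff, sum_eq, comp_eq]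

theorem valuesEval_perm {n : ℕ} (a : Fin n → R) (σ : Equiv.Perm (Fin n)) (v : Values L n) :
    valuesEval a (Values.perm σ v) = valuesEval (a ∘ σ) v := by
  rw [Values.perm, valuesEval_subst]
  simp [Function.comp_def]

theorem valuesEval_act (B : SesquilinearBracket L) {n : ℕ} (a : Fin (n + 1) → R)
    (i : Fin (n + 1)) (p : L) (v : Values L n) :
    valuesEval a (B.act i p v) = B.expAct (a i) (1 ⊗ₜ p) (valuesEval (i.removeNth a) v) := by
  obtain ⟨u, rfl⟩ := Values.mk_surjective n v
  have comp_eq : (MvPolynomial.aeval a).comp (MvPolynomial.rename i.succAbove) =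
      MvPolynomial.aeval (R := ℂ) (i.removeNth a) := by
    ext k; simp [Fin.removeNth]
  rw [B.act_mk, valuesEval_mk, valuesEval_mk, B.expAct_single, Fin.sum_univ_succAbove _ i,
    mapCoeff_extend, mapCoeff_mapCoeff, comp_eq, mapCoeff_tmul, map_one, MvPolynomial.aeval_X]
  rfl

theorem valuesEval_X_injective (n : ℕ) : Function.Injective
    (valuesEval (L := L) (MvPolynomial.X : Fin n → MvPolynomial (Fin n) ℂ)) := by
  refine (injective_iff_map_eq_zero _).2 fun v hv => ?_
  obtain ⟨u, rfl⟩ := Values.mk_surjective n v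
  rw [valuesEval_mk, MvPolynomial.aeval_X_left] at hv
  obtain ⟨w, hw⟩ := ExpModule.exists_of_single_eq_zero hv
  have hu : mapCoeff (AlgHom.id ℂ _) u = u := LinearMap.rTensor_id_apply _ _ u
  rw [← hu, ← hw]
  exact Values.mk_total n w

end ValuesEval

section Evaluation
variable {R L : Type*} [CommRing R] [Algebra ℂ R] [AddCommGroup L] [Module ℂ L] [Module ℂ[X] L]
  [IsScalarTower ℂ ℂ[X] L] {n : ℕ}

/-- The `R`-multilinear extension of a cochain, with `a` substituted for the variables `λ`. -/
noncomputable def evalAt (a : Fin n → R) :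
    MultilinearMap ℂ (fun _ : Fin n => L) (Values L n) →ₗ[ℂ]
      MultilinearMap R (fun _ : Fin n => R ⊗[ℂ] L) (ExpSums R L) :=
  liftMultilinear n ∘ₗ (valuesEval a).compMultilinearMapₗ ℂ

theorem evalAt_one_tmul (a : Fin n → R) (f : MultilinearMap ℂ (fun _ : Fin n => L) (Values L n))
    (p : Fin n → L) : evalAt a f (fun i => 1 ⊗ₜ p i) = valuesEval a (f p) :=
  liftMultilinear_one_tmul _ _

variable (R) in
/-- A cochain as a function of elements `u e^{ax}`, encoded as pairs `(a, u)`. -/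
noncomputable def evalCochain : MultilinearMap ℂ (fun _ : Fin n => L) (Values L n) →ₗ[ℂ]
    (Fin n → R × (R ⊗[ℂ] L)) → ExpSums R L where
  toFun f x := evalAt (Prod.fst ∘ x) f (Prod.snd ∘ x)
  map_add' f g := funext fun x => by rw [map_add]; rfl
  map_smul' c f := funext fun x => by rw [map_smul]; rfl

theorem evalCochain_apply (f : MultilinearMap ℂ (fun _ : Fin n => L) (Values L n))
    (x : Fin n → R × (R ⊗[ℂ] L)) :
    evalCochain R f x = evalAt (Prod.fst ∘ x) f (Prod.snd ∘ x) := rfl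

theorem evalCochain_injective :
    Function.Injective (evalCochain (L := L) (n := n) (MvPolynomial (Fin n) ℂ)) := fun f g h => by
  ext p
  refine valuesEval_X_injective n ?_
  have eval_eq := congrFun h fun i => (MvPolynomial.X i, 1 ⊗ₜ p i)
  exact (evalAt_one_tmul _ f p).symm.trans (eval_eq.trans (evalAt_one_tmul _ g p))

theorem evalAt_comp_perm (a : Fin n → R) (σ : Equiv.Perm (Fin n))
    {f : MultilinearMap ℂ (fun _ : Fin n => L) (Values L n)} (hf : f ∈ Cochain L n)
    (u : Fin n → R ⊗[ℂ] L) :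
    evalAt (a ∘ σ) f (u ∘ σ) = (Equiv.Perm.sign σ : ℤ) • evalAt a f u := by
  have h : (evalAt (a ∘ σ) f).domDomCongr σ = (Equiv.Perm.sign σ : ℤ) • evalAt a f :=
    multilinear_baseChange_ext fun p => by
      rw [MultilinearMap.domDomCongr_apply, smul_apply, evalAt_one_tmul,
        evalAt_one_tmul, ← valuesEval_perm, ← map_zsmul]
      exact congrArg _ (hf.2 σ p)
  exact congrArg (fun g => g u) h

theorem isSkew_evalCochain {f : MultilinearMap ℂ (fun _ : Fin n => L) (Values L n)}
    (hf : f ∈ Cochain L n) : IsSkew (evalCochain R f) := fun σ x =>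
  evalAt_comp_perm (Prod.fst ∘ x) σ hf (Prod.snd ∘ x)

theorem LieConformalAlgebra.respectsJacobi_evalCochain (A : LieConformalAlgebra L)
    (f : MultilinearMap ℂ (fun _ : Fin n => L) (Values L n)) :
    RespectsJacobi A.expBr (evalCochain R f) := fun p k x y z => by
  simp only [SesquilinearBracket.expBr, evalCochain_apply, Function.comp_update]
  rw [A.extend_jacobi, MultilinearMap.map_update_add, add_assoc, add_left_comm y.1]

theorem SesquilinearBracket.evalAt_actTerm (B : SesquilinearBracket L) (i : Fin (n + 1))
    (a : Fin (n + 1) → R) (f : MultilinearMap ℂ (fun _ : Fin n => L) (Values L n))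
    (u : Fin (n + 1) → R ⊗[ℂ] L) :
    evalAt a (B.actTerm i f) u =
      B.expAct (a i) (u i) (evalAt (i.removeNth a) f (i.removeNth u)) := by
  have h : evalAt a (B.actTerm i f) = LinearMap.uncurryMid (M := fun _ => R ⊗[ℂ] L) i
      { toFun := fun y => (B.expAct (a i) y).compMultilinearMap (evalAt (i.removeNth a) f)
        map_add' := fun x y => by ext p; simp
        map_smul' := fun c x => by ext p; simp } :=
    multilinear_baseChange_ext fun p => by
      rw [evalAt_one_tmul, B.actTerm_apply, valuesEval_act, ← evalAt_one_tmul]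
      rfl
  rw [h]
  rfl

theorem valuesEval_insertFirst (j : Fin (n + 2)) (i : Fin (n + 1)) (a : Fin (n + 2) → R)
    (b : MvPolynomial (Fin (n + 2)) ℂ)
    (f : MultilinearMap ℂ (fun _ : Fin (n + 1) => L) (Values L (n + 1)))
    (z : ℂ[X] ⊗[ℂ] L) (p : Fin n → L) :
    valuesEval a (insertFirst j i b f z p) =
      evalAt (Fin.cons (a (j.succAbove i) + a j) (i.removeNth (j.removeNth a))) f
        (Fin.cons (mapCoeff (Polynomial.aeval (MvPolynomial.aeval a b)) z) fun k => 1 ⊗ₜ p k) := by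
  induction z with
  | zero =>
    rw [map_zero, map_zero, zero_apply, map_zero]
    exact (MultilinearMap.map_coord_zero _ 0 rfl).symm
  | add x y hx hy =>
    rw [map_add, map_add, add_apply, map_add, hx, hy, ← MultilinearMap.cons_add]
  | tmul P c =>
    have substituted : (fun k => MvPolynomial.aeval a (mergeVars j i (MvPolynomial.X k))) =
        (Fin.cons (a (j.succAbove i) + a j) (i.removeNth (j.removeNth a)) : Fin (n + 1) → R) := by
      ext k
      cases k using Fin.cases <;> simp [mergeVars, Fin.removeNth]
    have cons_tmul : (Fin.cons (1 ⊗ₜ c) fun k => 1 ⊗ₜ p k : Fin (n + 1) → R ⊗[ℂ] L) =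
        fun k => 1 ⊗ₜ (Fin.cons c p : Fin (n + 1) → L) k :=
      (Fin.comp_cons (fun x : L => (1 : R) ⊗ₜ[ℂ] x) c p).symm
    rw [insertFirst_tmul, valuesEval_smul, valuesEval_subst, substituted, mapCoeff_tmul,
      TensorProduct.tmul_eq_smul_one_tmul, MultilinearMap.cons_smul, cons_tmul, evalAt_one_tmul,
      Polynomial.aeval_algHom_apply]

theorem SesquilinearBracket.evalAt_bracketTerm (B : SesquilinearBracket L) (j : Fin (n + 2))
    (i : Fin (n + 1)) (a : Fin (n + 2) → R)
    (f : MultilinearMap ℂ (fun _ : Fin (n + 1) => L) (Values L (n + 1)))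
    (u : Fin (n + 2) → R ⊗[ℂ] L) :
    evalAt a (B.bracketTerm j i f) u =
      evalAt (Fin.cons (a (j.succAbove i) + a j) (i.removeNth (j.removeNth a))) f
        (Fin.cons (extend B.bracket (a (j.succAbove i)) (u (j.succAbove i)) (u j))
          (i.removeNth (j.removeNth u))) := by
  set g := evalAt (Fin.cons (a (j.succAbove i) + a j) (i.removeNth (j.removeNth a))) f
  have h : evalAt a (B.bracketTerm j i f) = LinearMap.uncurryMid (M := fun _ => R ⊗[ℂ] L) j
      { toFun := fun y => LinearMap.uncurryMid (M := fun _ => R ⊗[ℂ] L) i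
          (g.curryLeft ∘ₗ (extend B.bracket (a (j.succAbove i))).flip y)
        map_add' := fun x y => by ext p; simp
        map_smul' := fun c x => by ext p; simp } :=
    multilinear_baseChange_ext fun p => by
      have extend_one_tmul : extend B.bracket (a (j.succAbove i)) (1 ⊗ₜ p (j.succAbove i))
          (1 ⊗ₜ p j) = mapCoeff (Polynomial.aeval (a (j.succAbove i)))
            (B.bracket (p (j.succAbove i)) (p j)) := by
        rw [extend_tmul, mul_one, one_smul]
      rw [evalAt_one_tmul, B.bracketTerm_apply, valuesEval_insertFirst, MvPolynomial.aeval_X,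
        ← extend_one_tmul]
      rfl
  rw [h]
  rfl

theorem SesquilinearBracket.evalCochain_bracketSum (B : SesquilinearBracket L)
    (f : MultilinearMap ℂ (fun _ : Fin n => L) (Values L n)) :
    evalCochain R (B.bracketSum f) = bracketD B.expBr (evalCochain R f) := by
  funext x
  cases n with
  | zero => rw [bracketSum, map_zero, bracketD]
  | succ m =>
    simp only [bracketSum, bracketD, map_sum, map_zsmul, Finset.sum_apply, Pi.smul_apply]
    simp only [evalCochain_apply, B.evalAt_bracketTerm, Fin.comp_cons]
    rfl

theorem SesquilinearBracket.evalCochain_actSum (B : SesquilinearBracket L)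
    (f : MultilinearMap ℂ (fun _ : Fin n => L) (Values L n)) (x : Fin (n + 1) → R × (R ⊗[ℂ] L)) :
    evalCochain R (B.actSum f) x =
      ∑ i : Fin (n + 1),
        ((-1 : ℤ) ^ (i : ℕ)) • B.expActHom (x i) (evalCochain R f (i.removeNth x)) := by
  simp only [actSum, map_sum, map_zsmul, Finset.sum_apply, Pi.smul_apply]
  simp only [evalCochain_apply, B.evalAt_actTerm]
  rfl

theorem LieConformalAlgebra.evalCochain_coboundary (A : LieConformalAlgebra L) (f : Cochain L n) :
    evalCochain R (A.coboundary n f).1 = leibnizD A.expBr A.expActHom (evalCochain R f.1) := by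
  rw [← (isSkew_evalCochain f.2).chevalleyD_eq]
  funext x
  rw [chevalleyD, ← A.evalCochain_bracketSum, ← A.evalCochain_actSum]
  exact congrFun (map_add (evalCochain R) (A.actSum f.1) (A.bracketSum f.1)) x

theorem LieConformalAlgebra.coboundary_coboundary (A : LieConformalAlgebra L) (f : Cochain L n) :
    A.coboundary (n + 1) (A.coboundary n f) = 0 :=
  Subtype.ext <| evalCochain_injective <| by
    rw [A.evalCochain_coboundary, A.evalCochain_coboundary,
      leibnizD_leibnizD A.isLeibnizAction_expActHom (A.respectsJacobi_evalCochain f.1)]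
    exact (map_zero (evalCochain _)).symm

end Evaluation

section Deformation
variable {L : Type*} [AddCommGroup L] [Module ℂ L] [Module ℂ[X] L] [IsScalarTower ℂ ℂ[X] L]
  {n : ℕ}

theorem SesquilinearBracket.act_compLeft (B : SesquilinearBracket L) (N : L →ₗ[ℂ[X]] L)
    (i : Fin (n + 1)) (p : L) (v : Values L n) : (B.compLeft N).act i p v = B.act i (N p) v := by
  obtain ⟨u, rfl⟩ := Values.mk_surjective n v
  have extend_compLeft : ∀ w, extend (B.compLeft N).bracket
      (MvPolynomial.X i : MvPolynomial (Fin (n + 1)) ℂ) (1 ⊗ₜ p) w =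
        extend B.bracket (MvPolynomial.X i) (1 ⊗ₜ N p) w := fun w => by
    induction w with
    | zero => rw [map_zero, map_zero]
    | add x y hx hy => rw [map_add, map_add, hx, hy]
    | tmul r q => rw [extend_tmul, extend_tmul]; rfl
  rw [B.act_mk, act_mk, extend_compLeft]

theorem SesquilinearBracket.act_deform (B : SesquilinearBracket L) (N : L →ₗ[ℂ[X]] L)
    (i : Fin (n + 1)) (p : L) (v : Values L n) :
    (B.deform N).act i p v = (B.compLeft N).act i p v + B.act i p (Values.map N n v) -
      Values.map N (n + 1) (B.act i p v) := by
  rw [B.act_compLeft]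
  obtain ⟨u, rfl⟩ := Values.mk_surjective n v
  rw [Values.map_mk, B.act_mk, B.act_mk, B.act_mk, (B.deform N).act_mk, Values.map_mk,
    B.extend_deform, LinearMap.map_sub, LinearMap.map_add, mapCoeff_baseChange,
    LinearMap.baseChange_tmul, LinearMap.restrictScalars_apply]

theorem SesquilinearBracket.actSum_deform (B : SesquilinearBracket L) (N : L →ₗ[ℂ[X]] L)
    (f : MultilinearMap ℂ (fun _ : Fin n => L) (Values L n)) :
    (B.deform N).actSum f = (B.compLeft N).actSum f +
      B.actSum ((Values.map N n).compMultilinearMap f) -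
        (Values.map N (n + 1)).compMultilinearMap (B.actSum f) := by
  ext p
  simp only [sub_apply, add_apply, LinearMap.compMultilinearMap_apply, actSum_apply, map_sum,
    map_zsmul, actTerm_apply, act_deform, smul_add, smul_sub, Finset.sum_add_distrib,
    Finset.sum_sub_distrib]

theorem Values.map_subst (N : L →ₗ[ℂ[X]] L) {m : ℕ}
    (e : MvPolynomial (Fin m) ℂ →ₐ[ℂ] MvPolynomial (Fin n) ℂ)
    (he : e (∑ k, MvPolynomial.X k) = ∑ k, MvPolynomial.X k) (v : Values L m) :
    Values.map N n (Values.subst e he v) = Values.subst e he (Values.map N m v) := by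
  obtain ⟨u, rfl⟩ := Values.mk_surjective m v
  rw [Values.map_mk, Values.subst_mk, Values.map_mk, Values.subst_mk, mapCoeff_baseChange]

theorem insertFirst_compMultilinearMap_map (N : L →ₗ[ℂ[X]] L) (j : Fin (n + 2))
    (i : Fin (n + 1)) (a : MvPolynomial (Fin (n + 2)) ℂ)
    (f : MultilinearMap ℂ (fun _ : Fin (n + 1) => L) (Values L (n + 1)))
    (z : ℂ[X] ⊗[ℂ] L) (p : Fin n → L) :
    insertFirst j i a ((Values.map N (n + 1)).compMultilinearMap f) z p =
      Values.map N (n + 2) (insertFirst j i a f z p) := by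
  induction z with
  | zero => simp only [map_zero, zero_apply]
  | add x y hx hy => rw [map_add, map_add, add_apply, add_apply, map_add, hx, hy]
  | tmul P c =>
    rw [insertFirst_tmul, insertFirst_tmul, Values.map_smul, Values.map_subst]
    rfl

theorem SesquilinearBracket.bracketSum_compMultilinearMap_map (B : SesquilinearBracket L)
    (N : L →ₗ[ℂ[X]] L) (f : MultilinearMap ℂ (fun _ : Fin n => L) (Values L n)) :
    B.bracketSum ((Values.map N n).compMultilinearMap f) =
      (Values.map N (n + 1)).compMultilinearMap (B.bracketSum f) := by
  ext p
  cases n with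
  | zero => exact (map_zero (Values.map N 1)).symm
  | succ m =>
    simp only [bracketSum, LinearMap.compMultilinearMap_apply, sum_apply, map_sum,
      smul_apply, map_zsmul, bracketTerm_apply, insertFirst_compMultilinearMap_map]

/-- The operation `f ↦ ∑_k f(…, N(p_k), …)` on multilinear maps. -/
noncomputable def sumComp (N : L →ₗ[ℂ[X]] L) (n : ℕ) :
    MultilinearMap ℂ (fun _ : Fin n => L) (Values L n) →ₗ[ℂ]
      MultilinearMap ℂ (fun _ : Fin n => L) (Values L n) :=
  ∑ k, MultilinearMap.compLinearMapₗ
    (Function.update (fun _ => LinearMap.id) k (N.restrictScalars ℂ))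

theorem sumComp_apply (N : L →ₗ[ℂ[X]] L)
    (f : MultilinearMap ℂ (fun _ : Fin n => L) (Values L n)) (p : Fin n → L) :
    sumComp N n f p = ∑ k, f (Function.update p k (N (p k))) := by
  rw [sumComp, LinearMap.sum_apply, sum_apply]
  refine Finset.sum_congr rfl fun k _ => congrArg f (funext fun l => ?_)
  rcases eq_or_ne l k with rfl | h
  · rw [Function.update_self, Function.update_self, LinearMap.restrictScalars_apply]
  · rw [Function.update_of_ne h, Function.update_of_ne h, LinearMap.id_apply]

theorem sumComp_mem (N : L →ₗ[ℂ[X]] L)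
    {f : MultilinearMap ℂ (fun _ : Fin n => L) (Values L n)} (hf : f ∈ Cochain L n) :
    sumComp N n f ∈ Cochain L n := by
  refine ⟨fun p k => ?_, fun σ p => ?_⟩
  · rw [sumComp_apply, sumComp_apply, Finset.smul_sum, ← Finset.sum_neg_distrib]
    refine Finset.sum_congr rfl fun l _ => ?_
    rw [← hf.1]
    rcases eq_or_ne k l with rfl | h
    · rw [Function.update_idem, Function.update_idem, Function.update_self, Function.update_self,
        del_comm]
    · rw [Function.update_of_ne h.symm, Function.update_of_ne h, Function.update_comm h]
  · rw [sumComp_apply, sumComp_apply, map_sum, Finset.smul_sum,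
      ← Equiv.sum_comp σ fun k => (Equiv.Perm.sign σ : ℤ) • f (Function.update p k (N (p k)))]
    refine Finset.sum_congr rfl fun l _ => ?_
    rw [← hf.2, Function.update_comp_eq_of_injective p σ.injective, Function.comp_apply]

theorem SesquilinearBracket.actTerm_sumComp (B : SesquilinearBracket L) (N : L →ₗ[ℂ[X]] L)
    (i : Fin (n + 1)) (f : MultilinearMap ℂ (fun _ : Fin n => L) (Values L n)) :
    sumComp N (n + 1) (B.actTerm i f) =
      (B.compLeft N).actTerm i f + B.actTerm i (sumComp N n f) := by
  ext p
  have removeNth_update : ∀ k, (fun l => Function.update p (i.succAbove k)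
      (N (p (i.succAbove k))) (i.succAbove l)) =
        Function.update (fun l => p (i.succAbove l)) k (N (p (i.succAbove k))) := fun k =>
    Function.update_comp_eq_of_injective p Fin.succAbove_right_injective k _
  simp only [sumComp_apply, Fin.sum_univ_succAbove _ i, add_apply, actTerm_apply, act_compLeft,
    map_sum, Function.update_self, ne_eq, Fin.succAbove_ne, Fin.ne_succAbove, not_false_eq_true,
    Function.update_of_ne, removeNth_update]

theorem SesquilinearBracket.actSum_sumComp (B : SesquilinearBracket L) (N : L →ₗ[ℂ[X]] L)
    (f : MultilinearMap ℂ (fun _ : Fin n => L) (Values L n)) :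
    sumComp N (n + 1) (B.actSum f) = (B.compLeft N).actSum f + B.actSum (sumComp N n f) := by
  simp only [actSum, map_sum, map_zsmul, B.actTerm_sumComp, smul_add, Finset.sum_add_distrib]

theorem insertFirst_sumComp (N : L →ₗ[ℂ[X]] L) (j : Fin (n + 2)) (i : Fin (n + 1))
    (a : MvPolynomial (Fin (n + 2)) ℂ)
    (f : MultilinearMap ℂ (fun _ : Fin (n + 1) => L) (Values L (n + 1)))
    (z : ℂ[X] ⊗[ℂ] L) (p : Fin n → L) :
    insertFirst j i a (sumComp N (n + 1) f) z p =
      insertFirst j i a f ((N.restrictScalars ℂ).baseChange ℂ[X] z) p +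
        ∑ k, insertFirst j i a f z (Function.update p k (N (p k))) := by
  induction z with
  | zero => simp only [map_zero, zero_apply, Finset.sum_const_zero, add_zero]
  | add x y hx hy =>
    simp only [map_add, add_apply, hx, hy, Finset.sum_add_distrib]
    abel
  | tmul P c =>
    simp only [LinearMap.baseChange_tmul, insertFirst_tmul, sumComp_apply, Fin.sum_univ_succ,
      map_add, smul_add, map_sum, Finset.smul_sum, Fin.cons_zero, Fin.cons_succ,
      Fin.update_cons_zero, Fin.cons_update, LinearMap.restrictScalars_apply]

theorem SesquilinearBracket.bracketTerm_sumComp (B : SesquilinearBracket L) (N : L →ₗ[ℂ[X]] L)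
    (j : Fin (n + 2)) (i : Fin (n + 1))
    (f : MultilinearMap ℂ (fun _ : Fin (n + 1) => L) (Values L (n + 1))) :
    sumComp N (n + 2) (B.bracketTerm j i f) =
      (B.deform N).bracketTerm j i f + B.bracketTerm j i (sumComp N (n + 1) f) := by
  ext p
  have removeNth_update : ∀ k, (fun l => Function.update p (j.succAbove (i.succAbove k))
      (N (p (j.succAbove (i.succAbove k)))) (j.succAbove (i.succAbove l))) =
        Function.update (fun l => p (j.succAbove (i.succAbove l))) k
          (N (p (j.succAbove (i.succAbove k)))) := fun k =>
    Function.update_comp_eq_of_injective p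
      (Fin.succAbove_right_injective.comp Fin.succAbove_right_injective) k _
  have deform_bracket : ∀ x y, (B.deform N).bracket x y = B.bracket (N x) y + B.bracket x (N y) -
      (N.restrictScalars ℂ).baseChange ℂ[X] (B.bracket x y) := fun _ _ => rfl
  simp only [sumComp_apply, Fin.sum_univ_succAbove _ j, Fin.sum_univ_succAbove _ i, add_apply,
    bracketTerm_apply, Function.update_self, Function.update_of_ne, ne_eq, Fin.succAbove_ne,
    Fin.ne_succAbove, Fin.succAbove_inj, not_false_eq_true, removeNth_update, deform_bracket,
    map_sub, map_add, sub_apply, insertFirst_sumComp]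
  abel

theorem SesquilinearBracket.bracketSum_sumComp (B : SesquilinearBracket L) (N : L →ₗ[ℂ[X]] L)
    (f : MultilinearMap ℂ (fun _ : Fin n => L) (Values L n)) :
    sumComp N (n + 1) (B.bracketSum f) =
      (B.deform N).bracketSum f + B.bracketSum (sumComp N n f) := by
  cases n with
  | zero => simp only [bracketSum, map_zero, add_zero]
  | succ m =>
    simp only [bracketSum, map_sum, map_zsmul, B.bracketTerm_sumComp, smul_add,
      Finset.sum_add_distrib]

/-- The map `f ↦ ∑_k f(…, N(p_k), …)` on cochains. -/
noncomputable def precomp (N : L →ₗ[ℂ[X]] L) (n : ℕ) : Cochain L n →ₗ[ℂ] Cochain L n :=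
  (sumComp N n).restrict fun _ => sumComp_mem N

namespace LieConformalAlgebra
variable (A : LieConformalAlgebra L) (N : L →ₗ[ℂ[X]] L)

theorem bracketSum_deform_mem {f : MultilinearMap ℂ (fun _ : Fin n => L) (Values L n)}
    (hf : f ∈ Cochain L n) : (A.deform N).bracketSum f ∈ Cochain L (n + 1) := by
  rw [← add_sub_cancel_right ((A.deform N).bracketSum f) (A.bracketSum (sumComp N n f)),
    ← A.bracketSum_sumComp]
  exact sub_mem (sumComp_mem N (A.bracketSum_mem hf)) (A.bracketSum_mem (sumComp_mem N hf))

/-- The part `∑_{i<j} (-1)^{i+j} f([p_i, p_j]_N, …)` of the coboundary, for the bracket deformed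
by a `ℂ[∂]`-linear map `N`, which need not be a Nijenhuis operator. -/
noncomputable def deformBracketMap (n : ℕ) : Cochain L n →ₗ[ℂ] Cochain L (n + 1) where
  toFun f := ⟨(A.deform N).bracketSum f.1, A.bracketSum_deform_mem N f.2⟩
  map_add' f g := Subtype.ext ((A.deform N).bracketSum_add f.1 g.1)
  map_smul' c f := Subtype.ext ((A.deform N).bracketSum_smul c f.1)

/-- The coboundary formula `δ_N` for the bracket deformed by a `ℂ[∂]`-linear map `N`. It squares to
zero when `N` is a Nijenhuis operator, not in general. -/
noncomputable def deformCoboundary (n : ℕ) : Cochain L n →ₗ[ℂ] Cochain L (n + 1) :=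
  (A.deform N).actMap n + A.deformBracketMap N n

/-- The formula for the differential `d_N`, for an arbitrary `ℂ[∂]`-linear map `N`. -/
noncomputable def deformDifferential (n : ℕ) : Cochain L n →ₗ[ℂ] Cochain L (n + 1) :=
  (A.compLeft N).actMap n + A.deformBracketMap N n - postcomp N (n + 1) ∘ₗ A.coboundary n

theorem actMap_compLeft_add_deformBracketMap (f : Cochain L n) :
    (A.compLeft N).actMap n f + A.deformBracketMap N n f =
      precomp N (n + 1) (A.coboundary n f) - A.coboundary n (precomp N n f) := by
  refine Subtype.ext ?_
  change (A.compLeft N).actSum f.1 + (A.deform N).bracketSum f.1 =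
    sumComp N (n + 1) (A.actSum f.1 + A.bracketSum f.1) -
      (A.actSum (sumComp N n f.1) + A.bracketSum (sumComp N n f.1))
  rw [map_add, A.actSum_sumComp, A.bracketSum_sumComp]
  abel

theorem actMap_deform (f : Cochain L n) :
    (A.deform N).actMap n f = (A.compLeft N).actMap n f +
      (A.coboundary n (postcomp N n f) - postcomp N (n + 1) (A.coboundary n f)) := by
  refine Subtype.ext ?_
  change (A.deform N).actSum f.1 = (A.compLeft N).actSum f.1 +
    (A.actSum ((Values.map N n).compMultilinearMap f.1) +
      A.bracketSum ((Values.map N n).compMultilinearMap f.1) -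
        (Values.map N (n + 1)).compMultilinearMap (A.actSum f.1 + A.bracketSum f.1))
  rw [A.actSum_deform, A.bracketSum_compMultilinearMap_map, LinearMap.compMultilinearMap_add]
  abel

theorem deformDifferential_eq (f : Cochain L n) :
    A.deformDifferential N n f = precomp N (n + 1) (A.coboundary n f) -
      A.coboundary n (precomp N n f) - postcomp N (n + 1) (A.coboundary n f) := by
  rw [← A.actMap_compLeft_add_deformBracketMap]
  rfl

theorem deformCoboundary_eq (f : Cochain L n) :
    A.deformCoboundary N n f =
      A.deformDifferential N n f + A.coboundary n (postcomp N n f) := by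
  rw [deformCoboundary, LinearMap.add_apply, A.actMap_deform, deformDifferential,
    LinearMap.sub_apply, LinearMap.add_apply, LinearMap.comp_apply]
  abel

theorem deformCoboundary_coboundary (f : Cochain L n) :
    A.deformCoboundary N (n + 1) (A.coboundary n f) =
      -A.coboundary (n + 1) (A.deformDifferential N n f) := by
  rw [A.deformCoboundary_eq, A.deformDifferential_eq, A.deformDifferential_eq]
  simp only [map_sub, A.coboundary_coboundary, map_zero]
  abel

theorem deformCoboundary_Phi (f : Cochain L n) :
    A.deformCoboundary N (n + 1) (A.Phi n f) = A.Phi (n + 1) (A.deformDifferential N n f) := by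
  simp only [Phi, LinearMap.smul_apply, map_zsmul, A.deformCoboundary_coboundary,
    pow_succ _ (n + 1), mul_neg, mul_one, neg_smul, smul_neg,
    LinearMap.neg_apply]

end LieConformalAlgebra

end Deformation

section CohomologyMap
variable {V W : ℕ → Type*} [∀ n, AddCommGroup (V n)] [∀ n, Module ℂ (V n)]
  [∀ n, AddCommGroup (W n)] [∀ n, Module ℂ (W n)] {D : ∀ n, V n →ₗ[ℂ] V (n + 1)}
  {E : ∀ n, W n →ₗ[ℂ] W (n + 1)} {φ : ∀ n, V n →ₗ[ℂ] W (n + 1)}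

theorem coboundaries_le_comap (h : ∀ n, E (n + 1) ∘ₗ φ n = φ (n + 1) ∘ₗ D n) :
    ∀ n, coboundaries D n ≤ (coboundaries E (n + 1)).comap (φ n)
  | 0 => bot_le
  | n + 1 => by
    rintro _ ⟨v, rfl⟩
    exact ⟨φ n v, LinearMap.congr_fun (h n) v⟩

theorem Cohomology.exists_map (h : ∀ n, E (n + 1) ∘ₗ φ n = φ (n + 1) ∘ₗ D n) (n : ℕ) :
    ∃ Ψ : Cohomology D n →ₗ[ℂ] Cohomology E (n + 1),
      ∀ (v : V n) (hv : D n v = 0), ∃ hw : E (n + 1) (φ n v) = 0,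
        Ψ (Cohomology.mk D n v hv) = Cohomology.mk E (n + 1) (φ n v) hw := by
  have maps_cocycles : ∀ v, D n v = 0 → E (n + 1) (φ n v) = 0 := fun v hv =>
    (LinearMap.congr_fun (h n) v).trans ((congrArg (φ (n + 1)) hv).trans (map_zero _))
  exact ⟨Submodule.mapQ _ _ ((φ n).restrict (p := LinearMap.ker (D n))
    (q := LinearMap.ker (E (n + 1))) maps_cocycles) fun v hv => coboundaries_le_comap h n hv,
    fun v hv => ⟨maps_cocycles v hv, rfl⟩⟩

end CohomologyMap

end LieConformal

theorem proposition3_general {L : Type*} [AddCommGroup L] [Module ℂ L] [Module ℂ[X] L]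
    [IsScalarTower ℂ ℂ[X] L] (A : LieConformal.LieConformalAlgebra L) (N : L →ₗ[ℂ[X]] L) :
    (∀ n : ℕ, A.deformCoboundary N (n + 1) ∘ₗ A.Phi n =
      A.Phi (n + 1) ∘ₗ A.deformDifferential N n) ∧
    ∀ n : ℕ, ∃ Ψ : LieConformal.Cohomology (A.deformDifferential N) n →ₗ[ℂ]
        LieConformal.Cohomology (A.deformCoboundary N) (n + 1),
      ∀ (f : LieConformal.Cochain L n) (hf : A.deformDifferential N n f = 0),
        ∃ hg : A.deformCoboundary N (n + 1) (A.Phi n f) = 0,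
          Ψ (LieConformal.Cohomology.mk (A.deformDifferential N) n f hf) =
            LieConformal.Cohomology.mk (A.deformCoboundary N) (n + 1) (A.Phi n f) hg :=
  have intertwines : ∀ n, A.deformCoboundary N (n + 1) ∘ₗ A.Phi n =
      A.Phi (n + 1) ∘ₗ A.deformDifferential N n := fun _ =>
    LinearMap.ext (A.deformCoboundary_Phi N)
  ⟨intertwines, LieConformal.Cohomology.exists_map intertwines⟩

theorem proposition3 {L : Type*} [AddCommGroup L] [Module ℂ L] [Module ℂ[X] L]
    [IsScalarTower ℂ ℂ[X] L] (A : LieConformal.LieConformalAlgebra L) (N : L →ₗ[ℂ[X]] L)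
    (hN : A.IsNijenhuis N) :
    (∀ n : ℕ, (A.deformed N hN).coboundary (n + 1) ∘ₗ A.Phi n =
      A.Phi (n + 1) ∘ₗ A.nijenhuisDifferential N hN n) ∧
    ∀ n : ℕ, ∃ Ψ : LieConformal.Cohomology (A.nijenhuisDifferential N hN) n →ₗ[ℂ]
        LieConformal.Cohomology (A.deformed N hN).coboundary (n + 1),
      ∀ (f : LieConformal.Cochain L n) (hf : A.nijenhuisDifferential N hN n f = 0),
        ∃ hg : (A.deformed N hN).coboundary (n + 1) (A.Phi n f) = 0,
          Ψ (LieConformal.Cohomology.mk (A.nijenhuisDifferential N hN) n f hf) =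
            LieConformal.Cohomology.mk (A.deformed N hN).coboundary (n + 1) (A.Phi n f) hg :=
  proposition3_general A N
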